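/- Let $T>0$, $I_T=[0,T]$, and let $X$ be the set of sequences $a=(a_1,a_2,\dots)$ of bounded measurable functions $a_i:I_T\to\mathbb C$ with $\sup_{x\in I_T,\,i\ge 1}|a_i(x)|^{1/i}<\infty$. For $a\in X$ put $$I_{i_1,\dots,i_k}(a)=\int\cdots\int_{0\le s_1\le\cdots\le s_k\le T}a_{i_k}(s_k)\cdots a_{i_1}(s_1)\,ds_k\cdots ds_1 .$$ Let $\mathcal A$ be the algebra of formal series $c_0I+\sum_{n\ge1}\big(\sum_{i_1+\cdots+i_k=n}c_{i_1,\dots,i_k}X_{i_1}\cdots X_{i_k}\big)t^n$ with complex coefficients in free noncommutative variables $X_1,X_2,\dots$, with the topology of coefficientwise convergence, and let $G\subset\mathcal A$ be the topological group of the series with $c_0=1$. For $a\in X$ let $E(a)=F_a(T)\in G$, where $F_a'=\big(\sum_{i\ge1}a_i t^iX_i\big)F_a$ on $I_T$ and $F_a(0)=I$; thus the coefficient of $X_{i_k}\cdots X_{i_1}$ in $E(a)$ is $I_{i_1,\dots,i_k}(a)$. The group of formal paths $G_f(X)$ is the closure of $\{E(a):a\in X\}$ in $G$ (equivalently, the completion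 of the group of paths, identified with its image in $G$). For $g\in G_f(X)$ let $\widehat I_{i_1,\dots,i_k}(g)$ be the coefficient of $X_{i_k}\cdots X_{i_1}$ in $g$, and let $$\widehat P(g)=r+\sum_{n\ge1}\Big(\sum_{i_1+\cdots+i_k=n}p_{i_1,\dots,i_k}(n)\,\widehat I_{i_1,\dots,i_k}(g)\Big)r^{n+1},\qquad p_{i_1,\dots,i_k}(z)=\prod_{j=1}^{k}(z-i_1-\cdots-i_j+1).$$ For $g=E(a)$ this is the first return map of $\frac{dv}{dx}=\sum_{i\ge1}a_i(x)v^{i+1}$. The group of formal centers is $\widehat{\mathcal C}_f=\{g\in G_f(X):\widehat P(g)=r\}$, the kernel of $\widehat P$. For positive integers $i_1,\dots,i_k$ with $k\ge2$ and $n=i_1+\cdots+i_k$ set $$v_{i_1,\dots,i_k}=[X_{i_1},[X_{i_2},[\cdots,[X_{i_{k-1}},X_{i_k}]\cdots]]]-\gamma_{i_1,\dots,i_k}X_n,\qquad \gamma_{i_1,\dots,i_k}=\prod_{s=1}^{k-1}\big(i_s-(i_{s+1}+\cdots+i_k)\big).$$ **Proposition 3.7.** Let $H$ be the subgroup generated by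 all elements $\exp\big(c\,v_{i_1,\dots,i_k}t^{i_1+\cdots+i_k}\big)$ with $k\ge2$, $i_1,\dots,i_k\ge1$ and $c\in\mathbb C$. Then $H\subset G_f(X)$, and $\widehat{\mathcal C}_f$ is the closure of $H$ in $G_f(X)$. -/

import Mathlib

open MeasureTheory

noncomputable section

namespace FormalCenters

/-! ### Words and noncommutative power series -/

/-- The weight `i₁ + ⋯ + i_k` of a word `(i₁, …, i_k)` of positive integers. -/
def wt (w : List ℕ+) : ℕ := (w.map (fun i : ℕ+ => (i : ℕ))).sum

/-- The word `(i₁, …, i_k)` of positive integers given by a composition `i₁ + ⋯ + i_k = n`. -/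
def compWord {n : ℕ} (κ : Composition n) : List ℕ+ := κ.blocks.map Nat.toPNat'

/-- The algebra `ℂ⟨X₁, X₂, …⟩` of noncommutative polynomials. -/
abbrev NCPoly : Type := FreeAlgebra ℂ ℕ+

/-- The algebra `ℂ⟨X₁, X₂, …⟩[[t]]`. -/
abbrev NCSeries : Type := PowerSeries NCPoly

/-- The variable `X_i`. -/
def X (i : ℕ+) : NCPoly := FreeAlgebra.ι ℂ i

/-- The monomial `X_{i₁} ⋯ X_{i_k}`. -/
def wordMonomial (w : List ℕ+) : NCPoly := (w.map X).prod

/-- `V_n`: the span of the monomials `X_{i₁} ⋯ X_{i_k}` with `i₁ + ⋯ + i_k = n`. -/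
def V (n : ℕ) : Submodule ℂ NCPoly := Submodule.span ℂ {p | ∃ w : List ℕ+, wt w = n ∧ wordMonomial w = p}

theorem wt_append (u v : List ℕ+) : wt (u ++ v) = wt u + wt v := by
  simp [wt]

theorem wordMonomial_mem (w : List ℕ+) : wordMonomial w ∈ V (wt w) :=
  Submodule.subset_span ⟨w, rfl, rfl⟩

theorem wt_compWord {n : ℕ} (κ : Composition n) : wt (compWord κ) = n := by
  have h : (κ.blocks.map Nat.toPNat').map (fun i : ℕ+ => (i : ℕ)) = κ.blocks := by
    rw [List.map_map]
    conv_rhs => rw [← List.map_id κ.blocks]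
    apply List.map_congr_left
    intro i hi
    have := κ.blocks_pos hi
    simp [Nat.toPNat'_coe, this]
  rw [wt, compWord, h, κ.blocks_sum]

theorem one_mem_V : (1 : NCPoly) ∈ V 0 :=
  Submodule.subset_span ⟨[], by simp [wt], by simp [wordMonomial]⟩

theorem mul_mem_V {m n : ℕ} {p q : NCPoly} (hp : p ∈ V m) (hq : q ∈ V n) : p * q ∈ V (m + n) := by
  have h := Submodule.mul_mem_mul hp hq
  rw [V, V, Submodule.span_mul_span] at h
  refine Submodule.span_mono ?_ h
  rintro _ ⟨_, ⟨u, hu, rfl⟩, _, ⟨v, hv, rfl⟩, rfl⟩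
  exact ⟨u ++ v, by rw [wt_append, hu, hv], by simp [wordMonomial]⟩

theorem X_mem (i : ℕ+) : X i ∈ V i :=
  Submodule.subset_span ⟨[i], by simp [wt], by simp [wordMonomial]⟩

/-- The algebra `𝒜` of the series `∑ f_n t^n` with `f_n ∈ V_n`, that is, of the series
`c₀ I + ∑_{n ≥ 1} (∑_{i₁+⋯+i_k = n} c_{i₁,…,i_k} X_{i₁} ⋯ X_{i_k}) t^n`. -/
def seriesAlg : Subalgebra ℂ NCSeries where
  carrier := {f | ∀ n, PowerSeries.coeff n f ∈ V n}
  mul_mem' := by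
    intro f g hf hg n
    rw [PowerSeries.coeff_mul]
    refine Submodule.sum_mem _ fun p hp => ?_
    rw [← Finset.HasAntidiagonal.mem_antidiagonal.mp hp]
    exact mul_mem_V (hf _) (hg _)
  add_mem' := by
    intro f g hf hg n
    rw [map_add]
    exact Submodule.add_mem _ (hf n) (hg n)
  algebraMap_mem' := by
    intro c n
    rw [Algebra.algebraMap_eq_smul_one, PowerSeries.coeff_smul, PowerSeries.coeff_one]
    split_ifs with h
    · subst h
      exact Submodule.smul_mem _ _ one_mem_V
    · simp

/-- The series `∑_n (∑_{i₁+⋯+i_k = n} c_{i₁,…,i_k} X_{i₁} ⋯ X_{i_k}) t^n` with prescribed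
coefficients (`c_∅` is the constant term). -/
def ofCoeff (c : List ℕ+ → ℂ) : NCSeries :=
  PowerSeries.mk fun n => ∑ κ : Composition n, c (compWord κ) • wordMonomial (compWord κ)

/-- The coefficient `c_{i₁,…,i_k}` of `X_{i₁} ⋯ X_{i_k} t^{i₁+⋯+i_k}` in a series. -/
def wordCoeff (f : NCSeries) (w : List ℕ+) : ℂ :=
  (FreeAlgebra.equivMonoidAlgebraFreeMonoid (PowerSeries.coeff (wt w) f)).coeff
    (FreeMonoid.ofList w)

theorem ofCoeff_mem (c : List ℕ+ → ℂ) : ofCoeff c ∈ seriesAlg := by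
  intro n
  rw [ofCoeff, PowerSeries.coeff_mk]
  refine Submodule.sum_mem _ fun κ _ => Submodule.smul_mem _ _ ?_
  have := wordMonomial_mem (compWord κ)
  rwa [wt_compWord] at this

/-! ### The group `G`, its Lie algebra and the exponential map -/

/-- The group `G` of the elements of `𝒜` with `c₀ = 1`, under multiplication. -/
def G : Subgroup NCSeriesˣ where
  carrier := {u | (u : NCSeries) ∈ seriesAlg ∧ PowerSeries.constantCoeff (u : NCSeries) = 1}
  mul_mem' := by
    rintro u v ⟨hu, hu1⟩ ⟨hv, hv1⟩
    exact ⟨by simpa using seriesAlg.mul_mem hu hv, by simp [hu1, hv1]⟩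
  one_mem' := ⟨by simp, by simp⟩
  inv_mem' := by
    rintro u ⟨hu, hu1⟩
    have h1 : PowerSeries.constantCoeff ((u⁻¹ : NCSeriesˣ) : NCSeries) = 1 := by
      have h := congrArg PowerSeries.constantCoeff u.mul_inv
      rw [map_mul, hu1, one_mul, map_one] at h
      exact h
    refine ⟨?_, h1⟩
    intro n
    induction n using Nat.strong_induction_on with
    | _ n ih =>
      rcases Nat.eq_zero_or_pos n with rfl | hn
      · rw [PowerSeries.coeff_zero_eq_constantCoeff_apply, h1]
        exact one_mem_V
      · have h := congrArg (PowerSeries.coeff n) u.mul_inv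
        rw [PowerSeries.coeff_mul, PowerSeries.coeff_one, if_neg hn.ne',
          ← Finset.add_sum_erase _ _ (a := (0, n)) (by simp),
          PowerSeries.coeff_zero_eq_constantCoeff_apply, hu1, one_mul] at h
        rw [eq_neg_of_add_eq_zero_left h]
        refine Submodule.neg_mem _ (Submodule.sum_mem _ fun p hp => ?_)
        rw [Finset.mem_erase, Finset.HasAntidiagonal.mem_antidiagonal] at hp
        obtain ⟨hne, hpn⟩ := hp
        have hlt : p.2 < n := by
          rcases p with ⟨a, b⟩
          simp only [ne_eq, Prod.mk.injEq, not_and] at hne hpn ⊢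
          by_contra hb
          exact hne (by omega) (by omega)
        rw [← hpn]
        exact mul_mem_V (hu _) (ih _ hlt)

/-- An element of `𝒜` with `c₀ = 1`, regarded as an element of `G`. -/
def G.of (f : NCSeries) (hf : f ∈ seriesAlg) (h1 : PowerSeries.constantCoeff f = 1) : G :=
  ⟨⟨f, PowerSeries.invOfUnit f 1, PowerSeries.mul_invOfUnit f 1 (by simpa using h1),
    PowerSeries.invOfUnit_mul f 1 (by simpa using h1)⟩, hf, h1⟩

/-- The series in `𝒜` underlying an element of `G`. -/
def ser (g : G) : NCSeries := ((g : NCSeriesˣ) : NCSeries)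

/-- `G` carries the weakest topology in which all coefficients `c_{i₁,…,i_k}` are continuous. -/
instance : TopologicalSpace G :=
  TopologicalSpace.induced (fun g : G => wordCoeff (ser g)) inferInstance

/-- The Lie algebra of `G`: the elements of `𝒜` with `c₀ = 0`. -/
def lieG : Submodule ℂ NCSeries where
  carrier := {f | f ∈ seriesAlg ∧ PowerSeries.constantCoeff f = 0}
  add_mem' := by
    rintro f g ⟨hf, hf0⟩ ⟨hg, hg0⟩
    exact ⟨seriesAlg.add_mem hf hg, by simp [hf0, hg0]⟩
  zero_mem' := ⟨seriesAlg.zero_mem, by simp⟩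
  smul_mem' := by
    rintro c f ⟨hf, hf0⟩
    refine ⟨seriesAlg.smul_mem hf c, ?_⟩
    rw [← PowerSeries.coeff_zero_eq_constantCoeff_apply] at hf0 ⊢
    rw [PowerSeries.coeff_smul, hf0, smul_zero]

/-- The series `e^f = ∑_k f^k / k!` for `f` without constant term; since `f^k` is then divisible
by `t^k`, only the terms with `k ≤ n` contribute to the coefficient of `t^n`. -/
def expSeries (f : NCSeries) : NCSeries :=
  PowerSeries.mk fun n =>
    ∑ k ∈ Finset.range (n + 1), ((k.factorial : ℂ)⁻¹) • PowerSeries.coeff n (f ^ k)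

/-- The exponential map from the Lie algebra of `G` to `G`. -/
def exp (f : lieG) : G :=
  G.of (expSeries f)
    (by
      intro n
      rw [expSeries, PowerSeries.coeff_mk]
      exact Submodule.sum_mem _ fun k _ =>
        Submodule.smul_mem _ _ (seriesAlg.pow_mem f.2.1 k n))
    (by
      rw [← PowerSeries.coeff_zero_eq_constantCoeff_apply, expSeries, PowerSeries.coeff_mk]
      simp)

/-! ### Paths, iterated integrals and the group of formal paths -/

/-- The space of the sequences `a = (a₁, a₂, …)` of bounded measurable complex functions on
`[0, T]` with `sup_{x, i} |a_i(x)|^{1/i} < ∞` (essential supremum). -/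
def pathCoeffs (T : ℝ) : Set (ℕ+ → ℝ → ℂ) :=
  {a | (∀ i, AEMeasurable (a i) (volume.restrict (Set.Icc 0 T))) ∧
    ∃ M : ℝ, ∀ i : ℕ+, ∀ᵐ x ∂(volume.restrict (Set.Icc 0 T)), ‖a i x‖ ≤ M ^ (i : ℕ)}

/-- Auxiliary iterated integral with the outermost index written first:
`∫_{0 ≤ s_k ≤ ⋯ ≤ s_1 ≤ x} a_{j₁}(s_1) ⋯ a_{j_k}(s_k)`. -/
def iterInt (a : ℕ+ → ℝ → ℂ) : List ℕ+ → ℝ → ℂ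
  | [], _ => 1
  | j :: w, x => ∫ s in (0 : ℝ)..x, a j s * iterInt a w s

/-- The basic iterated integral
`I_{i₁,…,i_k}(a) = ∫_{0 ≤ s_1 ≤ ⋯ ≤ s_k ≤ T} a_{i_k}(s_k) ⋯ a_{i₁}(s_1) ds_k ⋯ ds_1`. -/
def basicIntegral (T : ℝ) (a : ℕ+ → ℝ → ℂ) (i : List ℕ+) : ℂ := iterInt a i.reverse T

/-- `E(a) = F_a(T)`, where `F_a' = (∑ a_i t^i X_i) F_a` on `[0, T]` and `F_a(0) = I`.
Picard iteration multiplies by new factors on the left, so the coefficient of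
`X_{i_k} ⋯ X_{i₁}` in `F_a(T)` is `I_{i₁,…,i_k}(a)`. -/
def E (T : ℝ) (a : ℕ+ → ℝ → ℂ) : G :=
  G.of (ofCoeff fun w => basicIntegral T a w.reverse) (ofCoeff_mem _)
    (by
      rw [← PowerSeries.coeff_zero_eq_constantCoeff_apply, ofCoeff, PowerSeries.coeff_mk]
      have h : ∀ κ : Composition 0, compWord κ = [] := fun κ => by
        have h0 := κ.blocks_sum
        have : κ.blocks = [] := by
          rw [← List.length_eq_zero_iff]
          have := κ.length_le
          rw [Composition.length] at this
          omega
        simp [compWord, this]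
      simp [h, basicIntegral, iterInt, wordMonomial, composition_card])

/-- The group `G_f(X)` of formal paths: the completion of the group `G(X)` of paths, realized as
the closure in `G` of the image `{E(a)}` of `G(X)`. -/
def formalPaths (T : ℝ) : Set G := closure (E T '' pathCoeffs T)

/-- The basic iterated integral `Î_{i₁,…,i_k}` extended by continuity to formal paths: the
coefficient of `X_{i_k} ⋯ X_{i₁}`. -/
def formalIntegral (g : G) (i : List ℕ+) : ℂ := wordCoeff (ser g) i.reverse

/-! ### The first return map and the group of formal centers -/

/-- `p_{i₁,…,i_k}(z) = (z - i₁ + 1)(z - i₁ - i₂ + 1) ⋯ (z - i₁ - ⋯ - i_k + 1)`. -/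
def returnPoly (i : List ℕ+) (z : ℂ) : ℂ :=
  ∏ j ∈ Finset.range i.length, (z - (wt (i.take (j + 1)) : ℂ) + 1)

/-- The (formal) first return map
`P̂(g) = r + ∑_{n ≥ 1} (∑_{i₁+⋯+i_k = n} p_{i₁,…,i_k}(n) Î_{i₁,…,i_k}(g)) r^{n+1}`. -/
def firstReturn (g : G) : PowerSeries ℂ :=
  PowerSeries.X + PowerSeries.X * PowerSeries.mk fun n =>
    if n = 0 then 0
    else ∑ κ : Composition n, returnPoly (compWord κ) n * formalIntegral g (compWord κ)

/-- The group of formal centers: the kernel of `P̂` on `G_f(X)`, that is, the formal paths whose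
first return map is the identity series `r`. -/
def formalCenters (T : ℝ) : Set (formalPaths T) := {g | firstReturn g = PowerSeries.X}

/-! ### The elements `v_{i₁,…,i_k}` and the group they generate -/

/-- The nested commutator `[X_{i₁}, [X_{i₂}, […, [X_{i_{k-1}}, X_{i_k}] ⋯ ]]]`, for `k ≥ 1`. -/
def nestedBracket : List ℕ+ → NCPoly
  | [] => 0
  | [i] => X i
  | i :: j :: w => ⁅X i, nestedBracket (j :: w)⁆

/-- The integer `γ_{i₁,…,i_k} = ∏_{s=1}^{k-1} (i_s - (i_{s+1} + ⋯ + i_k))`, so `γ_n = 1`. -/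
def gam : List ℕ+ → ℤ
  | [] => 1
  | [_] => 1
  | i :: j :: w => ((i : ℤ) - (wt (j :: w) : ℤ)) * gam (j :: w)

/-- `v_{i₁,…,i_k} = [X_{i₁}, […, [X_{i_{k-1}}, X_{i_k}] ⋯ ]] - γ_{i₁,…,i_k} X_n` with
`n = i₁ + ⋯ + i_k`. -/
def v (i : List ℕ+) : NCPoly := nestedBracket i - (gam i : ℂ) • X (wt i).toPNat'

theorem nestedBracket_mem : ∀ i : List ℕ+, nestedBracket i ∈ V (wt i)
  | [] => by simp [nestedBracket]
  | [i] => by simpa [nestedBracket, wt] using X_mem i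
  | i :: j :: w => by
    have h := nestedBracket_mem (j :: w)
    have e : wt (i :: j :: w) = (i : ℕ) + wt (j :: w) := by simp [wt]
    rw [nestedBracket, Ring.lie_def, e]
    refine Submodule.sub_mem _ (mul_mem_V (X_mem i) h) ?_
    rw [add_comm]
    exact mul_mem_V h (X_mem i)

theorem wt_pos {i : List ℕ+} (hi : 2 ≤ i.length) : 0 < wt i := by
  match i, hi with
  | a :: w, _ =>
    have := a.pos
    simp [wt]

theorem v_mem {i : List ℕ+} (hi : 2 ≤ i.length) : v i ∈ V (wt i) := by
  refine Submodule.sub_mem _ (nestedBracket_mem i) (Submodule.smul_mem _ _ ?_)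
  have h := X_mem (wt i).toPNat'
  rwa [Nat.toPNat'_coe, if_pos (wt_pos hi)] at h

/-- The element `c v_{i₁,…,i_k} t^{i₁+⋯+i_k}` of the Lie algebra of `G`, for `k ≥ 2`. -/
def lieElem (i : List ℕ+) (hi : 2 ≤ i.length) (c : ℂ) : lieG :=
  c • ⟨PowerSeries.monomial (wt i) (v i), by
    refine ⟨fun n => ?_, ?_⟩
    · rw [PowerSeries.coeff_monomial]
      split_ifs with h
      · subst h
        exact v_mem hi
      · exact Submodule.zero_mem _
    · rw [← PowerSeries.coeff_zero_eq_constantCoeff_apply, PowerSeries.coeff_monomial,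
        if_neg (wt_pos hi).ne]⟩

/-- The group `H` generated by all the elements `exp(c v_{i₁,…,i_k} t^{i₁+⋯+i_k})`. -/
def H : Subgroup G :=
  Subgroup.closure {g | ∃ (i : List ℕ+) (hi : 2 ≤ i.length) (c : ℂ), exp (lieElem i hi c) = g}

end FormalCenters

end

/-! The proof works with the Euler derivation `θ = t d/dt` in place of a formal logarithm. Call `g`
of Lie type if `θg = Y g` with every coefficient of `Y` in the span of the nested commutators
(`lieType`). This condition is closed, and it linearizes well: if two such elements agree below
order `n`, their difference at `t^n` lies in `lieSpan n` (`coeff_sub_mem_lieSpan`).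

Every path is of Lie type. With `A = ∑ a_i t^i X_i` and `F' = A F`, the series `Y` defined by `θF =
Y F` must satisfy `Y' = θA + [A, Y]`, and Picard iteration gives it as a sum of iterated integrals
times nested commutators (`iterInt_log_deriv`, `coeff_ofCoeff_logCoeff`). Hence `formalPaths ⊆
lieType`. Conversely, group commutators of constant one-letter paths realize every nested commutator
as a leading term, so a correction order by order approximates any element of Lie type by products
of paths (`exists_singleGroup_agree`). Since `exp(c v t^n)` has logarithmic derivative `n c v t^n`,
it is of Lie type, and `H ⊆ formalPaths` follows.

For the return map, let `X_i` act by `(D_i f)(m) = (m + 1) f(m + i)`, so that `[D_i, D_j] = (i - j)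
D_{i+j}`. A nested commutator then acts as `γ D_n`, so all `v` act as zero and `H` acts trivially.
The coefficient of `r^{n+1}` in the return map is the linear functional `u ↦ (u · 1)(0)` applied to
the `t^n` coefficient (`coeff_firstReturn`); this shows that `H`, and by continuity its closure,
consists of centers.

For the other inclusion, let a center `g` agree with `h ∈ H` below order `n`. The discrepancy at
`t^n` lies in `lieSpan n` and is killed by the functional. Modulo the `v`, `lieSpan n` is spanned by
`X_n`, on which the functional equals 1, so the discrepancy is a combination of the `v` of weight
`n` (`mem_span_v`). A product of exponentials removes it, and induction on `n` puts `g` in the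
closure of `H`. -/

noncomputable section

namespace FormalCenters

/-! ### Coefficients of words -/

/-- The coefficient of the monomial `X_{i₁} ⋯ X_{i_k}` in a noncommutative polynomial. -/
def coefW (w : List ℕ+) : NCPoly →ₗ[ℂ] ℂ where
  toFun p := (FreeAlgebra.equivMonoidAlgebraFreeMonoid p).coeff (FreeMonoid.ofList w)
  map_add' p q := by simp
  map_smul' c p := by simp

theorem wordCoeff_eq (f : NCSeries) (w : List ℕ+) :
    wordCoeff f w = coefW w (PowerSeries.coeff (wt w) f) := rfl

@[simp] theorem wt_nil : wt [] = 0 := rfl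

@[simp] theorem wt_cons (i : ℕ+) (w : List ℕ+) : wt (i :: w) = i + wt w := by simp [wt]

theorem wt_reverse (w : List ℕ+) : wt w.reverse = wt w := by simp [wt, List.sum_reverse]

theorem wt_eq_zero {w : List ℕ+} : wt w = 0 ↔ w = [] := by
  cases w <;> simp

@[simp] theorem wordMonomial_nil : wordMonomial [] = 1 := rfl

@[simp] theorem wordMonomial_cons (i : ℕ+) (w : List ℕ+) :
    wordMonomial (i :: w) = X i * wordMonomial w := by simp [wordMonomial]

theorem wordMonomial_append (u w : List ℕ+) :
    wordMonomial (u ++ w) = wordMonomial u * wordMonomial w := by simp [wordMonomial]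

theorem equiv_wordMonomial (w : List ℕ+) :
    FreeAlgebra.equivMonoidAlgebraFreeMonoid (wordMonomial w)
      = MonoidAlgebra.of ℂ (FreeMonoid ℕ+) (FreeMonoid.ofList w) := by
  induction w with
  | nil => simp only [wordMonomial_nil, map_one, FreeMonoid.ofList_nil]
  | cons i w ih =>
    rw [wordMonomial_cons, map_mul, ih, FreeMonoid.ofList_cons, map_mul]
    congr 1
    simp [X, FreeAlgebra.equivMonoidAlgebraFreeMonoid]

theorem coefW_wordMonomial (u w : List ℕ+) :
    coefW u (wordMonomial w) = if u = w then 1 else 0 := by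
  change (FreeAlgebra.equivMonoidAlgebraFreeMonoid (wordMonomial w)).coeff _ = _
  rw [equiv_wordMonomial, MonoidAlgebra.of_apply, MonoidAlgebra.coeff_single]
  classical
  rw [Finsupp.single_apply]
  simp [eq_comm]

theorem coefW_ext {p q : NCPoly} (h : ∀ w, coefW w p = coefW w q) : p = q := by
  apply FreeAlgebra.equivMonoidAlgebraFreeMonoid.injective
  ext w
  exact h (FreeMonoid.toList w)

theorem span_wordMonomial : Submodule.span ℂ (Set.range wordMonomial) = ⊤ := by
  rw [eq_top_iff]
  rintro p -
  induction p using FreeAlgebra.induction with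
  | grade0 r =>
    rw [Algebra.algebraMap_eq_smul_one]
    exact Submodule.smul_mem _ _ (Submodule.subset_span ⟨[], rfl⟩)
  | grade1 i => exact Submodule.subset_span ⟨[i], by simp [X]⟩
  | mul a b ha hb =>
    have h := Submodule.mul_mem_mul ha hb
    rw [Submodule.span_mul_span] at h
    refine Submodule.span_mono ?_ h
    rintro _ ⟨_, ⟨u, rfl⟩, _, ⟨v, rfl⟩, rfl⟩
    exact ⟨u ++ v, wordMonomial_append u v⟩
  | add a b ha hb => exact Submodule.add_mem _ ha hb

theorem word_hom_ext {M : Type*} [AddCommMonoid M] [Module ℂ M] {f g : NCPoly →ₗ[ℂ] M}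
    (h : ∀ w, f (wordMonomial w) = g (wordMonomial w)) : f = g :=
  LinearMap.ext_on_range span_wordMonomial h

/-- The sum `∑_{w = uv} c(u) d(v)` over the factorizations of a word. -/
def conv (c d : List ℕ+ → ℂ) (w : List ℕ+) : ℂ :=
  ∑ k ∈ Finset.range (w.length + 1), c (w.take k) * d (w.drop k)

theorem conv_nil (c d : List ℕ+ → ℂ) : conv c d [] = c [] * d [] := by simp [conv]

theorem conv_cons (c d : List ℕ+ → ℂ) (i : ℕ+) (w : List ℕ+) :
    conv c d (i :: w) = c [] * d (i :: w) + conv (fun u => c (i :: u)) d w := by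
  rw [conv, List.length_cons, Finset.sum_range_succ', add_comm]
  simp [conv]

theorem conv_zero_left (d : List ℕ+ → ℂ) (w : List ℕ+) : conv (fun _ => 0) d w = 0 := by
  simp [conv]

theorem coefW_wordMonomial_append (v : List ℕ+) : ∀ u w : List ℕ+,
    coefW w (wordMonomial (u ++ v))
      = conv (fun x => coefW x (wordMonomial u)) (fun x => coefW x (wordMonomial v)) w
  | [], [] => by simp only [conv_nil, coefW_wordMonomial]; simp
  | [], i :: w => by
    simp only [conv_cons, coefW_wordMonomial, reduceCtorEq, if_false, conv_zero_left]
    simp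
  | j :: u, [] => by simp only [conv_nil, coefW_wordMonomial]; simp
  | j :: u, i :: w => by
    have h := coefW_wordMonomial_append v u w
    simp only [conv_cons, coefW_wordMonomial] at h ⊢
    by_cases hij : i = j
    · subst hij
      simpa using h
    · simp [hij, conv_zero_left]

theorem coefW_wordMonomial_mul (u w : List ℕ+) (q : NCPoly) :
    coefW w (wordMonomial u * q) = conv (fun v => coefW v (wordMonomial u)) (fun v => coefW v q) w := by
  suffices h : coefW w ∘ₗ LinearMap.mulLeft ℂ (wordMonomial u)
      = ∑ k ∈ Finset.range (w.length + 1), coefW (w.take k) (wordMonomial u) • coefW (w.drop k) by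
    have := LinearMap.congr_fun h q
    simpa [conv] using this
  refine word_hom_ext fun v => ?_
  simpa [conv, ← wordMonomial_append] using coefW_wordMonomial_append v u w

theorem coefW_mul (p q : NCPoly) (w : List ℕ+) :
    coefW w (p * q) = conv (fun v => coefW v p) (fun v => coefW v q) w := by
  suffices h : coefW w ∘ₗ LinearMap.mulRight ℂ q
      = ∑ k ∈ Finset.range (w.length + 1), coefW (w.drop k) q • coefW (w.take k) by
    have := LinearMap.congr_fun h p
    simpa [conv, mul_comm] using this
  refine word_hom_ext fun v => ?_
  simpa [conv, mul_comm] using coefW_wordMonomial_mul v w q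

theorem coefW_X_mul_cons (i j : ℕ+) (u : List ℕ+) (p : NCPoly) :
    coefW (j :: u) (X i * p) = if j = i then coefW u p else 0 := by
  suffices h : coefW (j :: u) ∘ₗ LinearMap.mulLeft ℂ (X i) = if j = i then coefW u else 0 by
    have := LinearMap.congr_fun h p
    split_ifs at this ⊢ <;> simpa using this
  refine word_hom_ext fun v => ?_
  by_cases hji : j = i <;> simp [← wordMonomial_cons, coefW_wordMonomial, hji]

theorem coefW_mul_X_append (i j : ℕ+) (u : List ℕ+) (p : NCPoly) :
    coefW (u ++ [j]) (p * X i) = if j = i then coefW u p else 0 := by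
  suffices h : coefW (u ++ [j]) ∘ₗ LinearMap.mulRight ℂ (X i) = if j = i then coefW u else 0 by
    have := LinearMap.congr_fun h p
    split_ifs at this ⊢ <;> simpa using this
  refine word_hom_ext fun v => ?_
  have hX : X i = wordMonomial [i] := by simp
  by_cases hji : j = i <;>
    simp [hX, ← wordMonomial_append, coefW_wordMonomial, hji, -wordMonomial_cons]

theorem coefW_eq_zero {n : ℕ} {p : NCPoly} (hp : p ∈ V n) {w : List ℕ+} (hw : wt w ≠ n) :
    coefW w p = 0 := by
  have : V n ≤ LinearMap.ker (coefW w) := by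
    refine Submodule.span_le.mpr ?_
    rintro _ ⟨u, hu, rfl⟩
    simp only [SetLike.mem_coe, LinearMap.mem_ker, coefW_wordMonomial]
    rw [if_neg]
    rintro rfl
    exact hw hu
  exact this hp

/-! ### The finite set of words of a given weight -/

theorem toPNat'_coe_blocks {n : ℕ} (κ : Composition n) :
    (compWord κ).map (fun i : ℕ+ => (i : ℕ)) = κ.blocks := by
  rw [compWord, List.map_map]
  conv_rhs => rw [← List.map_id κ.blocks]
  apply List.map_congr_left
  intro i hi
  have := κ.blocks_pos hi
  simp [Nat.toPNat'_coe, this]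

theorem compWord_injective {n : ℕ} : Function.Injective (compWord : Composition n → List ℕ+) := by
  intro κ κ' h
  ext1
  rw [← toPNat'_coe_blocks, ← toPNat'_coe_blocks, h]

/-- The words of weight `n`. -/
def words (n : ℕ) : Finset (List ℕ+) := Finset.univ.image (compWord : Composition n → List ℕ+)

theorem mem_words {n : ℕ} {w : List ℕ+} : w ∈ words n ↔ wt w = n := by
  simp only [words, Finset.mem_image, Finset.mem_univ, true_and]
  constructor
  · rintro ⟨κ, rfl⟩
    exact wt_compWord κ
  · intro h
    refine ⟨⟨w.map (fun i : ℕ+ => (i : ℕ)), ?_, h⟩, ?_⟩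
    · intro i hi
      obtain ⟨j, -, rfl⟩ := List.mem_map.mp hi
      exact j.pos
    · simp [compWord, Function.comp_def]

theorem sum_composition {M : Type*} [AddCommMonoid M] (n : ℕ) (f : List ℕ+ → M) :
    ∑ κ : Composition n, f (compWord κ) = ∑ w ∈ words n, f w := by
  rw [words, Finset.sum_image (compWord_injective.injOn)]

theorem sum_words_cons {M : Type*} [AddCommMonoid M] {n m : ℕ} (i : ℕ+) (hn : n = i + m)
    (f g : List ℕ+ → M) (h0 : f [] = 0)
    (hf : ∀ j w, f (j :: w) = if j = i then g w else 0) :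
    ∑ w ∈ words n, f w = ∑ w ∈ words m, g w := by
  symm
  refine Finset.sum_of_injOn (fun w => i :: w) (by simp [Set.InjOn]) ?_ ?_ ?_
  · intro w hw
    simp only [Finset.mem_coe, mem_words] at hw ⊢
    simp [hw, hn]
  · intro w hw hw'
    cases w with
    | nil => exact h0
    | cons j w =>
      rw [hf, if_neg]
      rintro rfl
      refine hw' ⟨w, ?_, rfl⟩
      simp only [Finset.mem_coe, mem_words, wt_cons] at hw ⊢
      omega
  · intro w _
    simp [hf]

theorem sum_words_reverse {M : Type*} [AddCommMonoid M] (n : ℕ) (f : List ℕ+ → M) :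
    ∑ w ∈ words n, f w.reverse = ∑ w ∈ words n, f w := by
  refine Finset.sum_nbij' List.reverse List.reverse ?_ ?_ ?_ ?_ ?_ <;>
    simp [mem_words, wt_reverse]

theorem eq_sum_words {n : ℕ} {p : NCPoly} (hp : p ∈ V n) :
    p = ∑ w ∈ words n, coefW w p • wordMonomial w := by
  refine coefW_ext fun u => ?_
  simp only [map_sum, map_smul, coefW_wordMonomial, smul_eq_mul, mul_ite, mul_one, mul_zero]
  rw [Finset.sum_ite_eq]
  split_ifs with h
  · rfl
  · exact coefW_eq_zero hp (by rwa [mem_words] at h)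

/-! ### Word coefficients of series -/

theorem wordCoeff_ofCoeff (c : List ℕ+ → ℂ) (w : List ℕ+) : wordCoeff (ofCoeff c) w = c w := by
  rw [wordCoeff_eq, ofCoeff, PowerSeries.coeff_mk,
    sum_composition (wt w) (fun u => c u • wordMonomial u)]
  simp [coefW_wordMonomial, mem_words]

theorem series_ext {f g : NCSeries} (hf : f ∈ seriesAlg) (hg : g ∈ seriesAlg)
    (h : ∀ w, wordCoeff f w = wordCoeff g w) : f = g := by
  ext n
  rw [eq_sum_words (hf n), eq_sum_words (hg n)]
  refine Finset.sum_congr rfl fun w hw => ?_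
  obtain rfl := mem_words.mp hw
  rw [← wordCoeff_eq, ← wordCoeff_eq, h]

theorem coefW_coeff {f : NCSeries} (hf : f ∈ seriesAlg) (w : List ℕ+) (n : ℕ) :
    coefW w (PowerSeries.coeff n f) = if wt w = n then wordCoeff f w else 0 := by
  split_ifs with h
  · subst h; rfl
  · exact coefW_eq_zero (hf n) h

theorem wordCoeff_mul {f g : NCSeries} (hf : f ∈ seriesAlg) (hg : g ∈ seriesAlg) (w : List ℕ+) :
    wordCoeff (f * g) w = conv (wordCoeff f) (wordCoeff g) w := by
  rw [wordCoeff_eq, PowerSeries.coeff_mul, map_sum]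
  simp only [coefW_mul, conv]
  rw [Finset.sum_comm]
  refine Finset.sum_congr rfl fun k _ => ?_
  have hk : wt (w.take k) + wt (w.drop k) = wt w := by
    rw [← wt_append, List.take_append_drop]
  -- Both factors are homogeneous in each degree, so a cut of the word determines the only pair of
  -- degrees that contributes.
  rw [Finset.sum_eq_single (wt (w.take k), wt (w.drop k))]
  · rfl
  · rintro ⟨a, b⟩ _ hne
    simp only [coefW_coeff hf, coefW_coeff hg]
    by_cases ha : wt (w.take k) = a
    · have hb : wt (w.drop k) ≠ b := fun hb => hne (by rw [ha, hb])
      simp [hb]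
    · simp [ha]
  · intro h
    exact absurd (Finset.HasAntidiagonal.mem_antidiagonal.mpr hk) h

/-! ### Absolutely continuous functions and iterated integrals -/

/-- `f` is absolutely continuous on `[0, T]` with almost everywhere derivative `f'`. -/
def ACDeriv (T : ℝ) (f f' : ℝ → ℂ) : Prop :=
  AbsolutelyContinuousOnInterval f 0 T ∧ ∀ᵐ x, x ∈ Set.uIcc 0 T → HasDerivAt f (f' x) x

namespace ACDeriv

variable {T : ℝ} {f g f' g' : ℝ → ℂ}

theorem const (T : ℝ) (c : ℂ) : ACDeriv T (fun _ => c) (fun _ => 0) :=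
  ⟨(LipschitzWith.const c).lipschitzOnWith.absolutelyContinuousOnInterval,
    Filter.Eventually.of_forall fun x _ => hasDerivAt_const x c⟩

theorem add (hf : ACDeriv T f f') (hg : ACDeriv T g g') :
    ACDeriv T (fun x => f x + g x) (fun x => f' x + g' x) := by
  refine ⟨hf.1.add hg.1, ?_⟩
  filter_upwards [hf.2, hg.2] with x h1 h2 hx using (h1 hx).add (h2 hx)

theorem mul (hf : ACDeriv T f f') (hg : ACDeriv T g g') :
    ACDeriv T (fun x => f x * g x) (fun x => f' x * g x + f x * g' x) := by
  refine ⟨hf.1.smul hg.1, ?_⟩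
  filter_upwards [hf.2, hg.2] with x h1 h2 hx using (h1 hx).mul (h2 hx)

theorem const_mul (c : ℂ) (hf : ACDeriv T f f') :
    ACDeriv T (fun x => c * f x) (fun x => c * f' x) := by
  simpa using (const T c).mul hf

theorem sub (hf : ACDeriv T f f') (hg : ACDeriv T g g') :
    ACDeriv T (fun x => f x - g x) (fun x => f' x - g' x) := by
  simpa [sub_eq_add_neg] using hf.add (hg.const_mul (-1))

theorem sum {ι : Type*} (s : Finset ι) {f f' : ι → ℝ → ℂ} (h : ∀ i ∈ s, ACDeriv T (f i) (f' i)) :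
    ACDeriv T (fun x => ∑ i ∈ s, f i x) (fun x => ∑ i ∈ s, f' i x) := by
  classical
  induction s using Finset.induction_on with
  | empty => simpa using const T 0
  | insert i s hi ih =>
    simp only [Finset.sum_insert hi]
    exact (h i (by simp)).add (ih fun j hj => h j (by simp [hj]))

theorem congr_deriv (hf : ACDeriv T f f') (h : ∀ x ∈ Set.uIcc 0 T, f' x = g' x) :
    ACDeriv T f g' := by
  refine ⟨hf.1, ?_⟩
  filter_upwards [hf.2] with x hx hxT
  rw [← h x hxT]
  exact hx hxT

theorem eq_zero (hf : ACDeriv T f (fun _ => 0)) (h0 : f 0 = 0) : ∀ x ∈ Set.uIcc 0 T, f x = 0 := by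
  obtain ⟨C, hC⟩ := hf.1.const_of_ae_hasDerivAt_zero hf.2
  intro x hx
  rw [hC x hx, ← hC 0 (by simp), h0]

theorem of_integral (hf : IntervalIntegrable f volume 0 T) {C : ℝ}
    (hC : ∀ᵐ x, x ∈ Set.uIcc 0 T → ‖f x‖ ≤ C) : ACDeriv T (fun x => ∫ s in (0 : ℝ)..x, f s) f := by
  constructor
  · refine LipschitzOnWith.absolutelyContinuousOnInterval (K := C.toNNReal) ?_
    refine LipschitzOnWith.of_dist_le_mul fun x hx y hy => ?_
    have hx' : IntervalIntegrable f volume 0 x := hf.mono_set (Set.uIcc_subset_uIcc_left hx)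
    have hy' : IntervalIntegrable f volume 0 y := hf.mono_set (Set.uIcc_subset_uIcc_left hy)
    rw [dist_eq_norm, intervalIntegral.integral_interval_sub_left hx' hy', Real.dist_eq]
    refine intervalIntegral.norm_integral_le_of_norm_le_const_ae ?_
    filter_upwards [hC] with s hs hsm
    refine (hs ?_).trans (Real.le_coe_toNNReal C)
    exact Set.uIcc_subset_uIcc hy hx (Set.uIoc_subset_uIcc hsm)
  · filter_upwards [hf.ae_hasDerivAt_integral] with x hx hxT using hx hxT 0 (by simp)

end ACDeriv

theorem pathCoeffs_ae_bound {T : ℝ} (hT : 0 < T) {a : ℕ+ → ℝ → ℂ} (ha : a ∈ pathCoeffs T) (i : ℕ+) :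
    ∃ C : ℝ, ∀ᵐ x, x ∈ Set.uIcc 0 T → ‖a i x‖ ≤ C := by
  obtain ⟨M, hM⟩ := ha.2
  refine ⟨M ^ (i : ℕ), ?_⟩
  rw [Set.uIcc_of_le hT.le]
  exact (ae_restrict_iff' measurableSet_Icc).mp (hM i)

theorem pathCoeffs_intervalIntegrable {T : ℝ} (hT : 0 < T) {a : ℕ+ → ℝ → ℂ} (ha : a ∈ pathCoeffs T)
    (i : ℕ+) : IntervalIntegrable (a i) volume 0 T := by
  obtain ⟨M, hM⟩ := ha.2
  rw [intervalIntegrable_iff_integrableOn_Icc_of_le hT.le]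
  exact Integrable.of_bound (ha.1 i).aestronglyMeasurable (M ^ (i : ℕ)) (hM i)

theorem iterInt_cons_zero (a : ℕ+ → ℝ → ℂ) (j : ℕ+) (w : List ℕ+) : iterInt a (j :: w) 0 = 0 := by
  simp [iterInt]

/-- A bounded function times an absolutely continuous one is bounded and integrable, so its
primitive is Lipschitz. This is the induction step for iterated integrals. -/
theorem ACDeriv.mul_integral {T : ℝ} {f g g' : ℝ → ℂ} (hf : IntervalIntegrable f volume 0 T) {C : ℝ}
    (hC : ∀ᵐ x, x ∈ Set.uIcc 0 T → ‖f x‖ ≤ C) (hg : ACDeriv T g g') :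
    ACDeriv T (fun x => ∫ s in (0 : ℝ)..x, f s * g s) (fun x => f x * g x) := by
  obtain ⟨D, hD⟩ := hg.1.exists_bound
  refine ACDeriv.of_integral (C := C * D) (hf.mul_continuousOn hg.1.continuousOn) ?_
  filter_upwards [hC] with x hx hxT
  rw [norm_mul]
  exact mul_le_mul (hx hxT) (hD x hxT) (norm_nonneg _) ((norm_nonneg _).trans (hx hxT))

/-- The almost everywhere derivative of an iterated integral. -/
def iterIntDeriv (a : ℕ+ → ℝ → ℂ) : List ℕ+ → ℝ → ℂ
  | [], _ => 0
  | j :: w, x => a j x * iterInt a w x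

theorem acDeriv_iterInt {T : ℝ} (hT : 0 < T) {a : ℕ+ → ℝ → ℂ} (ha : a ∈ pathCoeffs T) :
    ∀ w, ACDeriv T (iterInt a w) (iterIntDeriv a w)
  | [] => ACDeriv.const T 1
  | j :: w => by
    obtain ⟨C, hC⟩ := pathCoeffs_ae_bound hT ha j
    exact ACDeriv.mul_integral (pathCoeffs_intervalIntegrable hT ha j) hC (acDeriv_iterInt hT ha w)

/-! ### The logarithmic derivative of `E(a)` -/

/-- The last letter of a word, and `0` for the empty word. -/
def lastLetter : List ℕ+ → ℕ
  | [] => 0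
  | [i] => i
  | _ :: j :: w => lastLetter (j :: w)

/-- The coefficient of a word in the series `Y(x)` with `(t d/dt) F_a(x) = Y(x) F_a(x)`. -/
def logCoeff (a : ℕ+ → ℝ → ℂ) (u : List ℕ+) (x : ℝ) : ℂ :=
  ∑ w ∈ words (wt u), (lastLetter w : ℂ) * coefW u (nestedBracket w) * iterInt a w x

theorem logCoeff_nil (a : ℕ+ → ℝ → ℂ) (x : ℝ) : logCoeff a [] x = 0 := by
  refine Finset.sum_eq_zero fun w hw => ?_
  obtain rfl := wt_eq_zero.mp (mem_words.mp hw)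
  simp [lastLetter]

/-- The almost everywhere derivative of `logCoeff`. -/
def logCoeffDeriv (a : ℕ+ → ℝ → ℂ) : List ℕ+ → ℝ → ℂ
  | [], _ => 0
  | i :: m, x => (if m = [] then (i : ℂ) * a i x else 0) + a i x * logCoeff a m x
      - a ((i :: m).getLast (by simp)) x * logCoeff a (i :: m).dropLast x

theorem coefW_nestedBracket_cons (u w : List ℕ+) (j i k : ℕ+) (m m' : List ℕ+) (hu : u = i :: m)
    (hu' : u = m' ++ [k]) (hw : w ≠ []) : coefW u (nestedBracket (j :: w))
      = (if j = i then coefW m (nestedBracket w) else 0)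
        - (if j = k then coefW m' (nestedBracket w) else 0) := by
  cases w with
  | nil => exact absurd rfl hw
  | cons l w =>
    rw [nestedBracket, Ring.lie_def, map_sub]
    congr 1
    · rw [hu, coefW_X_mul_cons]; simp [eq_comm]
    · rw [hu', coefW_mul_X_append]; simp [eq_comm]

/-- This is `Y' = θA + AY - YA` read off at one word: `AY` strips the first letter and `YA` the
last. The one-letter words in the sum produce `θA`. -/
theorem sum_iterIntDeriv (a : ℕ+ → ℝ → ℂ) (u : List ℕ+) (x : ℝ) :
    ∑ w ∈ words (wt u), (lastLetter w : ℂ) * coefW u (nestedBracket w) * iterIntDeriv a w x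
      = logCoeffDeriv a u x := by
  cases u with
  | nil =>
    refine Finset.sum_eq_zero fun w hw => ?_
    obtain rfl := wt_eq_zero.mp (mem_words.mp hw)
    simp [lastLetter]
  | cons i m =>
    set m' := (i :: m).dropLast with hm'
    set k := (i :: m).getLast (by simp) with hk
    have hu' : i :: m = m' ++ [k] := (List.dropLast_append_getLast _).symm
    have hterm : ∀ w ∈ words (wt (i :: m)),
        (lastLetter w : ℂ) * coefW (i :: m) (nestedBracket w) * iterIntDeriv a w x
          = (if w = [i] ∧ m = [] then (i : ℂ) * a i x else 0)
            + (match w with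
                | [] => 0
                | j :: w => if j = i then a i x *
                    ((lastLetter w : ℂ) * coefW m (nestedBracket w) * iterInt a w x) else 0)
            - (match w with
                | [] => 0
                | j :: w => if j = k then a k x *
                    ((lastLetter w : ℂ) * coefW m' (nestedBracket w) * iterInt a w x) else 0) := by
      intro w _
      match w with
      | [] => simp [lastLetter]
      | [j] =>
        have : coefW (i :: m) (X j) = if i :: m = [j] then 1 else 0 := by
          rw [← coefW_wordMonomial]; simp
        simp only [lastLetter, nestedBracket, iterIntDeriv, iterInt, this]
        by_cases h : i :: m = [j]
        · obtain ⟨rfl, rfl⟩ := List.cons.inj h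
          simp
        · rw [if_neg h, if_neg]
          · simp
          · rintro ⟨h1, rfl⟩
            exact h h1.symm
      | j :: l :: w =>
        rw [coefW_nestedBracket_cons (i :: m) (l :: w) j i k m m' rfl hu' (by simp)]
        simp only [iterIntDeriv, lastLetter, List.cons.injEq, reduceCtorEq, and_false, false_and, if_false]
        by_cases h1 : j = i <;> by_cases h2 : j = k
        · subst h1; simp only [← h2, if_true]; ring
        · subst h1; simp only [h2, if_true, if_false]; ring
        · subst h2; simp only [h1, if_true, if_false]; ring
        · simp [h1, h2]
    rw [Finset.sum_congr rfl hterm, Finset.sum_sub_distrib, Finset.sum_add_distrib]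
    have hwt : wt (i :: m) = k + wt m' := by
      rw [hu', wt_append]; simp [add_comm]
    have hsum : ∀ (n p : ℕ) (l : ℕ+) (f : List ℕ+ → ℂ), n = l + p →
        ∑ w ∈ words n, (match w with
          | [] => 0
          | j :: w => if j = l then f w else 0) = ∑ w ∈ words p, f w :=
      fun n p l f h => sum_words_cons l h _ f rfl fun _ _ => rfl
    rw [hsum _ _ i (fun w => a i x * _) (wt_cons i m), hsum _ _ k (fun w => a k x * _) hwt,
      ← Finset.mul_sum, ← Finset.mul_sum]
    rw [logCoeffDeriv]
    congr 2
    by_cases hm : m = []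
    · subst hm
      simp [mem_words]
    · simp [hm]

theorem acDeriv_logCoeff {T : ℝ} (hT : 0 < T) {a : ℕ+ → ℝ → ℂ} (ha : a ∈ pathCoeffs T)
    (u : List ℕ+) : ACDeriv T (logCoeff a u) (logCoeffDeriv a u) := by
  refine (ACDeriv.sum (words (wt u)) fun w _ => (acDeriv_iterInt hT ha w).const_mul
    ((lastLetter w : ℂ) * coefW u (nestedBracket w))).congr_deriv fun x _ => ?_
  exact sum_iterIntDeriv a u x

/-- This is `θF = Y F`, coefficient by coefficient. The derivative of `θF - YF` is `A(θF - YF)`,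
whose coefficient at a word involves only the word without its first letter; by induction it
vanishes, and so does the difference at `x = 0`. -/
theorem iterInt_log_deriv {T : ℝ} (hT : 0 < T) {a : ℕ+ → ℝ → ℂ} (ha : a ∈ pathCoeffs T) :
    ∀ w, ∀ x ∈ Set.uIcc 0 T, (wt w : ℂ) * iterInt a w x
      = conv (fun u => logCoeff a u x) (fun u => iterInt a u x) w
  | [], x, _ => by simp [conv_nil, logCoeff_nil]
  | i :: w, x, hx => by
    have ih := iterInt_log_deriv hT ha w
    set L := i :: w with hL
    have hd := ((acDeriv_iterInt hT ha L).const_mul (wt L : ℂ)).sub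
      (ACDeriv.sum (Finset.range (L.length + 1)) fun k _ =>
        (acDeriv_logCoeff hT ha (L.take k)).mul (acDeriv_iterInt hT ha (L.drop k)))
    refine sub_eq_zero.mp ((hd.congr_deriv (g' := fun _ => 0) ?_).eq_zero ?_ x hx)
    · intro x hx
      specialize ih x hx
      -- The end terms are split off because they carry the derivative of an empty word, which is
      -- zero. After the shift, the `-YA` part of `Y'F` at `k + 1` cancels `YF'` at `k`.
      rw [sub_eq_zero, Finset.sum_add_distrib, Finset.sum_range_succ',
        Finset.sum_range_succ _ L.length]
      have h1 : ∀ k ∈ Finset.range L.length,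
          logCoeffDeriv a (L.take (k + 1)) x * iterInt a (L.drop (k + 1)) x
            = (if k = 0 then (i : ℂ) * a i x * iterInt a w x else 0)
              + a i x * (logCoeff a (w.take k) x * iterInt a (w.drop k) x)
              - logCoeff a (L.take k) x * iterIntDeriv a (L.drop k) x := by
        intro k hk
        have hk' : k < L.length := Finset.mem_range.mp hk
        have e1 : (L.take (k + 1)).dropLast = L.take k := by
          rw [List.take_succ_eq_append_getElem hk', List.dropLast_concat]
        have e2 : L.drop k = L[k] :: L.drop (k + 1) := List.drop_eq_getElem_cons hk'
        have e3 : (L.take (k + 1)).getLast (by simp [hL]) = L[k] := by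
          simp only [List.take_succ_eq_append_getElem hk', List.getLast_append_singleton]
        have e4 : L.take (k + 1) = i :: w.take k := by simp [hL]
        have e5 : L.drop (k + 1) = w.drop k := by simp [hL]
        rw [e2, iterIntDeriv]
        simp only [e4] at e1 e3 ⊢
        rw [logCoeffDeriv, e1, e3]
        simp only [e5]
        rcases Nat.eq_zero_or_pos k with rfl | hk0
        · simp; ring
        · by_cases hw : w.take k = []
          · have : w = [] := by
              rcases List.take_eq_nil_iff.mp hw with h | h
              · omega
              · exact h
            subst this
            simp [hL] at hk'
            omega
          · simp [hw, hk0.ne']; ring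
      rw [Finset.sum_congr rfl h1, Finset.sum_sub_distrib, Finset.sum_add_distrib,
        Finset.sum_ite_eq' (Finset.range L.length) 0, if_pos (by simp [hL]), ← Finset.mul_sum]
      have hc : ∑ k ∈ Finset.range L.length, logCoeff a (w.take k) x * iterInt a (w.drop k) x
          = wt w * iterInt a w x := by rw [ih]; rfl
      rw [hc]
      simp only [List.take_zero, List.drop_length, iterIntDeriv, logCoeffDeriv, hL, wt_cons]
      push_cast
      ring
    · rw [sub_eq_zero]
      simp only [hL, iterInt_cons_zero, mul_zero]
      symm
      -- At `x = 0` a nonempty right factor vanishes; if it is empty, the left factor is the full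
      -- word, and `logCoeff` vanishes there.
      refine Finset.sum_eq_zero fun k hk => ?_
      by_cases h : (i :: w).drop k = []
      · have : (i :: w).take k = i :: w := by
          rw [List.take_eq_self_iff]; simpa using h
        rw [this]
        have : logCoeff a (i :: w) 0 = 0 := by
          refine Finset.sum_eq_zero fun u hu => ?_
          cases u with
          | nil => simp [lastLetter]
          | cons j u => simp [iterInt_cons_zero]
        simp [this]
      · obtain ⟨j, u, h⟩ := List.exists_cons_of_ne_nil h
        rw [h, iterInt_cons_zero, mul_zero]

/-! ### Leading terms of series -/

theorem ser_mem (g : G) : ser g ∈ seriesAlg := g.2.1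

@[simp] theorem constantCoeff_ser (g : G) : PowerSeries.constantCoeff (ser g) = 1 := g.2.2

@[simp] theorem coeff_zero_ser (g : G) : PowerSeries.coeff 0 (ser g) = 1 := by
  rw [PowerSeries.coeff_zero_eq_constantCoeff_apply, constantCoeff_ser]

@[simp] theorem ser_mul (g h : G) : ser (g * h) = ser g * ser h := rfl

@[simp] theorem ser_one : ser 1 = 1 := rfl

@[simp] theorem ser_mul_ser_inv (g : G) : ser g * ser g⁻¹ = 1 := by
  rw [← ser_mul, mul_inv_cancel, ser_one]

@[simp] theorem ser_inv_mul_ser (g : G) : ser g⁻¹ * ser g = 1 := by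
  rw [← ser_mul, inv_mul_cancel, ser_one]

theorem ser_injective : Function.Injective ser := fun _ _ h => Subtype.ext (Units.ext h)

/-- The series `f` is divisible by `t^n`. -/
def VanishBelow (n : ℕ) (f : NCSeries) : Prop := ∀ k < n, PowerSeries.coeff k f = 0

namespace VanishBelow

variable {m n : ℕ} {f g : NCSeries}

theorem zero (f : NCSeries) : VanishBelow 0 f := fun _ h => absurd h (Nat.not_lt_zero _)

theorem mono (hf : VanishBelow n f) (h : m ≤ n) : VanishBelow m f := fun k hk => hf k (hk.trans_le h)

theorem add (hf : VanishBelow n f) (hg : VanishBelow n g) : VanishBelow n (f + g) := fun k hk => by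
  rw [map_add, hf k hk, hg k hk, add_zero]

theorem sub (hf : VanishBelow n f) (hg : VanishBelow n g) : VanishBelow n (f - g) := fun k hk => by
  rw [map_sub, hf k hk, hg k hk, sub_zero]

theorem mul (hf : VanishBelow m f) (hg : VanishBelow n g) : VanishBelow (m + n) (f * g) := by
  intro k hk
  rw [PowerSeries.coeff_mul]
  refine Finset.sum_eq_zero fun p hp => ?_
  have := Finset.HasAntidiagonal.mem_antidiagonal.mp hp
  by_cases h : p.1 < m
  · rw [hf _ h, zero_mul]
  · rw [hg p.2 (by omega), mul_zero]

theorem coeff_mul (hf : VanishBelow m f) (hg : VanishBelow n g) :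
    PowerSeries.coeff (m + n) (f * g) = PowerSeries.coeff m f * PowerSeries.coeff n g := by
  rw [PowerSeries.coeff_mul, Finset.sum_eq_single (m, n)]
  · rintro ⟨a, b⟩ hp hne
    have := Finset.HasAntidiagonal.mem_antidiagonal.mp hp
    simp only at this ⊢
    by_cases h : a < m
    · rw [hf _ h, zero_mul]
    · by_cases h' : b < n
      · rw [hg _ h', mul_zero]
      · exact absurd (Prod.ext_iff.mpr ⟨by simp; omega, by simp; omega⟩) hne
  · intro h
    exact (h (Finset.HasAntidiagonal.mem_antidiagonal.mpr rfl)).elim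

theorem mul_left (hf : VanishBelow n f) (g : NCSeries) : VanishBelow n (g * f) := by
  simpa using (zero g).mul hf

theorem mul_right (hf : VanishBelow n f) (g : NCSeries) : VanishBelow n (f * g) := by
  simpa using hf.mul (zero g)

theorem coeff_mul_right (hf : VanishBelow n f) (g : NCSeries) :
    PowerSeries.coeff n (f * g) = PowerSeries.coeff n f * PowerSeries.coeff 0 g := by
  simpa using hf.coeff_mul (zero g)

theorem coeff_mul_left (hf : VanishBelow n f) (g : NCSeries) :
    PowerSeries.coeff n (g * f) = PowerSeries.coeff 0 g * PowerSeries.coeff n f := by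
  simpa using (zero g).coeff_mul hf

end VanishBelow

/-- `g = 1 + u t^n + ⋯`. -/
def HasLead (n : ℕ) (u : NCPoly) (g : G) : Prop :=
  VanishBelow n (ser g - 1) ∧ PowerSeries.coeff n (ser g - 1) = u

namespace HasLead

variable {m n : ℕ} {p q : NCPoly} {g h : G}

theorem one (n : ℕ) : HasLead n 0 1 := by constructor <;> simp [VanishBelow]

theorem mul (hn : 0 < n) (hg : HasLead n p g) (hh : HasLead n q h) : HasLead n (p + q) (g * h) := by
  have e : ser (g * h) - 1 = (ser g - 1) + (ser h - 1) + (ser g - 1) * (ser h - 1) := by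
    rw [ser_mul]; noncomm_ring
  have hv := hg.1.mul hh.1
  refine ⟨?_, ?_⟩
  · rw [e]
    exact (hg.1.add hh.1).add (hv.mono (by omega))
  · rw [e, map_add, map_add, hg.2, hh.2, hv n (by omega), add_zero]

theorem commutator (hg : HasLead m p g) (hh : HasLead n q h) :
    HasLead (m + n) ⁅p, q⁆ (g * h * g⁻¹ * h⁻¹) := by
  -- With `p = g - 1` and `q = h - 1`, one has `ghg⁻¹h⁻¹ - 1 = (pq - qp)(hg)⁻¹`, and the last factor
  -- has constant term 1.
  have e : ser (g * h * g⁻¹ * h⁻¹) - 1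
      = ((ser g - 1) * (ser h - 1) - (ser h - 1) * (ser g - 1)) * ser (g⁻¹ * h⁻¹) := by
    have e1 : (ser g - 1) * (ser h - 1) - (ser h - 1) * (ser g - 1)
        = ser g * ser h - ser h * ser g := by noncomm_ring
    have e2 : ser h * ser g * ser (g⁻¹ * h⁻¹) = 1 := by
      rw [← ser_mul, ← ser_mul, ← ser_one]; congr 1; group
    rw [e1, sub_mul, e2]
    simp only [ser_mul, mul_assoc]
  have h1 := hg.1.mul hh.1
  have h2 := hh.1.mul hg.1
  rw [add_comm n m] at h2
  have h3 := h1.sub h2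
  refine ⟨?_, ?_⟩
  · rw [e]
    exact h3.mul_right _
  · rw [e, h3.coeff_mul_right, coeff_zero_ser, mul_one, map_sub, hg.1.coeff_mul hh.1, add_comm m n,
      hh.1.coeff_mul hg.1, hg.2, hh.2, Ring.lie_def]

end HasLead

/-- Successive approximation: since `g - kh = (g - h) - (k - 1)h` and `h` has constant term 1, a
factor `k` whose leading term is the discrepancy removes it without disturbing lower orders. -/
theorem exists_agree_of_lead (S : Subgroup G) (g : G)
    (hS : ∀ n, 0 < n → ∀ h ∈ S, VanishBelow n (ser g - ser h) →
      ∃ k ∈ S, HasLead n (PowerSeries.coeff n (ser g - ser h)) k) (n : ℕ) :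
    ∃ h ∈ S, VanishBelow n (ser g - ser h) := by
  induction n with
  | zero => exact ⟨1, S.one_mem, VanishBelow.zero _⟩
  | succ n ih =>
    obtain ⟨h, hh, hv⟩ := ih
    rcases Nat.eq_zero_or_pos n with rfl | hn
    · refine ⟨h, hh, fun k hk => ?_⟩
      obtain rfl : k = 0 := by omega
      simp
    · obtain ⟨k, hk, hlead⟩ := hS n hn h hh hv
      refine ⟨k * h, S.mul_mem hk hh, fun j hj => ?_⟩
      have e : ser g - ser (k * h) = (ser g - ser h) - (ser k - 1) * ser h := by
        rw [ser_mul]; noncomm_ring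
      rw [e, map_sub]
      rcases Nat.lt_succ_iff_lt_or_eq.mp hj with hj | rfl
      · rw [hv j hj, hlead.1.mul_right _ j hj, sub_zero]
      · rw [hlead.1.coeff_mul_right, hlead.2, coeff_zero_ser, mul_one, sub_self]

theorem exists_lead_of_mem_span (S : Subgroup G) {n : ℕ} (hn : 0 < n) (s : Set NCPoly)
    (hs : ∀ u ∈ s, ∀ c : ℂ, ∃ k ∈ S, HasLead n (c • u) k) {u : NCPoly}
    (hu : u ∈ Submodule.span ℂ s) : ∃ k ∈ S, HasLead n u k := by
  -- Products in the group only add leading terms, so scalars must be carried through the induction.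
  suffices h : ∀ c : ℂ, ∃ k ∈ S, HasLead n (c • u) k by simpa using h 1
  induction hu using Submodule.span_induction with
  | mem u hu => exact hs u hu
  | zero => exact fun c => ⟨1, S.one_mem, by simpa using HasLead.one n⟩
  | add p q _ _ hp hq =>
    intro c
    obtain ⟨k, hk, hlk⟩ := hp c
    obtain ⟨l, hl, hll⟩ := hq c
    exact ⟨k * l, S.mul_mem hk hl, by rw [smul_add]; exact hlk.mul hn hll⟩
  | smul d p _ hp =>
    intro c
    rw [smul_smul]
    exact hp (c * d)

/-! ### The topology of `G` -/

theorem continuous_wordCoeff (w : List ℕ+) : Continuous fun g : G => wordCoeff (ser g) w :=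
  by
  have h : Continuous fun g : G => wordCoeff (ser g) := continuous_induced_dom
  exact continuous_pi_iff.mp h w

/-- Along the approximating sequence each word coefficient is eventually constant. -/
theorem mem_closure_of_agree {S : Set G} {g : G}
    (h : ∀ n, ∃ h ∈ S, VanishBelow n (ser g - ser h)) : g ∈ closure S := by
  choose f hf hv using h
  refine mem_closure_of_tendsto (b := Filter.atTop) (f := f) ?_ (Filter.Eventually.of_forall hf)
  rw [nhds_induced, Filter.tendsto_comap_iff, tendsto_pi_nhds]
  intro w
  refine tendsto_const_nhds.congr' ?_
  filter_upwards [Filter.eventually_gt_atTop (wt w)] with n hn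
  have := hv n (wt w) hn
  rw [map_sub, sub_eq_zero] at this
  simp only [Function.comp_apply, wordCoeff_eq, this]

theorem wordCoeff_one (w : List ℕ+) : wordCoeff 1 w = if w = [] then 1 else 0 := by
  rw [wordCoeff_eq, PowerSeries.coeff_one]
  cases w with
  | nil =>
    rw [wt_nil, if_pos rfl, if_pos rfl, ← wordMonomial_nil, coefW_wordMonomial, if_pos rfl]
  | cons i w => simp

theorem wordCoeff_ser_nil (g : G) : wordCoeff (ser g) [] = 1 := by
  rw [wordCoeff_eq, wt_nil, coeff_zero_ser, ← wordMonomial_nil, coefW_wordMonomial, if_pos rfl]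

/-- Solving `g⁻¹g = 1` for the coefficient of `w` expresses it by coefficients of `g` and those of
`g⁻¹` at strictly shorter prefixes. -/
theorem continuous_wordCoeff_inv (w : List ℕ+) :
    Continuous fun g : G => wordCoeff (ser g⁻¹) w := by
  have h : ∀ g : G, wordCoeff (ser g⁻¹) w = (if w = [] then 1 else 0)
      - ∑ k ∈ Finset.range w.length, wordCoeff (ser g⁻¹) (w.take k) * wordCoeff (ser g) (w.drop k) := by
    intro g
    have := wordCoeff_mul (ser_mem g⁻¹) (ser_mem g) w
    rw [ser_inv_mul_ser, wordCoeff_one, conv, Finset.sum_range_succ, List.take_length,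
      List.drop_length, wordCoeff_ser_nil, mul_one] at this
    rw [this]; ring
  simp_rw [h]
  refine continuous_const.sub (continuous_finsetSum _ fun k hk => ?_)
  have hk' := Finset.mem_range.mp hk
  have : (w.take k).length < w.length := by rw [List.length_take]; omega
  exact (continuous_wordCoeff_inv (w.take k)).mul (continuous_wordCoeff _)
termination_by w.length

/-! ### The Euler derivation `t d/dt` -/

/-- The derivation `t d/dt` of formal series. -/
def euler (f : NCSeries) : NCSeries := PowerSeries.mk fun n => (n : ℂ) • PowerSeries.coeff n f

@[simp] theorem coeff_euler (f : NCSeries) (n : ℕ) :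
    PowerSeries.coeff n (euler f) = (n : ℂ) • PowerSeries.coeff n f := by simp [euler]

theorem euler_mem {f : NCSeries} (hf : f ∈ seriesAlg) : euler f ∈ seriesAlg := fun n => by
  rw [coeff_euler]; exact Submodule.smul_mem _ _ (hf n)

theorem wordCoeff_euler (f : NCSeries) (w : List ℕ+) :
    wordCoeff (euler f) w = wt w * wordCoeff f w := by
  simp [wordCoeff_eq]

theorem euler_mul (f g : NCSeries) : euler (f * g) = euler f * g + f * euler g := by
  ext n
  rw [coeff_euler, map_add, PowerSeries.coeff_mul, PowerSeries.coeff_mul, PowerSeries.coeff_mul,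
    ← Finset.sum_add_distrib, Finset.smul_sum]
  refine Finset.sum_congr rfl fun p hp => ?_
  rw [← Finset.HasAntidiagonal.mem_antidiagonal.mp hp]
  simp [add_smul]

theorem euler_sub (f g : NCSeries) : euler (f - g) = euler f - euler g := by
  ext n; simp [smul_sub]

theorem euler_C (p : NCPoly) : euler (PowerSeries.C p) = 0 := by
  ext n; rw [coeff_euler, PowerSeries.coeff_C]; split_ifs with h <;> simp [h]

theorem euler_one : euler 1 = 0 := by simpa using euler_C 1

theorem VanishBelow.euler {n : ℕ} {f : NCSeries} (hf : VanishBelow n f) : VanishBelow n (euler f) :=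
  fun k hk => by rw [coeff_euler, hf k hk, smul_zero]

theorem VanishBelow.of_euler {n : ℕ} {f : NCSeries} (hf : VanishBelow n (FormalCenters.euler f))
    (h0 : PowerSeries.coeff 0 f = 0) : VanishBelow n f := fun k hk => by
  rcases Nat.eq_zero_or_pos k with rfl | hk0
  · exact h0
  · have := hf k hk
    rw [coeff_euler, smul_eq_zero] at this
    exact this.resolve_left (by exact_mod_cast hk0.ne')

/-- Uniqueness for `θf = Zf`: multiplication by `Z` raises the order of vanishing, and `θ` is
invertible in positive degrees. -/
theorem eq_zero_of_euler_eq {Z f : NCSeries} (hZ : VanishBelow 1 Z) (h0 : PowerSeries.coeff 0 f = 0)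
    (h : euler f = Z * f) : f = 0 := by
  have hv : ∀ n, VanishBelow n f := by
    intro n
    induction n with
    | zero => exact VanishBelow.zero f
    | succ n ih =>
      refine VanishBelow.of_euler ?_ h0
      rw [h, add_comm]
      exact hZ.mul ih
  ext n
  exact hv (n + 1) n (Nat.lt_succ_self n)

theorem HasLead.of_euler {n : ℕ} (hn : 0 < n) {Y : NCSeries} {g : G} (hY : VanishBelow n Y)
    (h : euler (ser g) = Y * ser g) : HasLead n ((n : ℂ)⁻¹ • PowerSeries.coeff n Y) g := by
  have h' : euler (ser g - 1) = Y * ser g := by rw [euler_sub, euler_one, sub_zero, h]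
  refine ⟨VanishBelow.of_euler ?_ (by simp), ?_⟩
  · rw [h']
    exact hY.mul_right _
  · have := congrArg (PowerSeries.coeff n) h'
    rw [coeff_euler, hY.coeff_mul_right, coeff_zero_ser, mul_one] at this
    rw [← this, smul_smul, inv_mul_cancel₀ (by exact_mod_cast hn.ne'), one_smul]

/-! ### Elements with logarithmic derivative in the free Lie algebra -/

/-- The span of the nested commutators of weight `n`. -/
def lieSpan (n : ℕ) : Submodule ℂ NCPoly := Submodule.span ℂ {p | ∃ w : List ℕ+, wt w = n ∧ nestedBracket w = p}

theorem nestedBracket_mem_lieSpan (w : List ℕ+) : nestedBracket w ∈ lieSpan (wt w) :=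
  Submodule.subset_span ⟨w, rfl, rfl⟩

theorem lieSpan_zero : lieSpan 0 = ⊥ := by
  rw [lieSpan, Submodule.span_eq_bot]
  rintro _ ⟨w, hw, rfl⟩
  rw [wt_eq_zero.mp hw]
  rfl

/-- The elements of `G` whose logarithmic derivative `Y`, given by `t g' = Y g`, has all its
coefficients in the free Lie algebra. -/
def lieType : Set G :=
  {g | ∃ Y : NCSeries, (∀ n, PowerSeries.coeff n Y ∈ lieSpan n) ∧ euler (ser g) = Y * ser g}

theorem vanishBelow_one_of_lieSpan {Y : NCSeries} (hY : ∀ n, PowerSeries.coeff n Y ∈ lieSpan n) :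
    VanishBelow 1 Y := fun k hk => by
  obtain rfl : k = 0 := by omega
  have := hY 0
  rwa [lieSpan_zero, Submodule.mem_bot] at this

/-- Comparing orders in `(Y - Y')g = θ(g - h) - Y'(g - h)` gives `Y_n - Y'_n = n (g - h)_n`, because
`Y'` has no constant term. -/
theorem coeff_sub_mem_lieSpan {g h : G} (hg : g ∈ lieType) (hh : h ∈ lieType) {n : ℕ} (hn : 0 < n)
    (hv : VanishBelow n (ser g - ser h)) : PowerSeries.coeff n (ser g - ser h) ∈ lieSpan n := by
  obtain ⟨Y, hY, eY⟩ := hg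
  obtain ⟨Y', hY', eY'⟩ := hh
  have e : (Y - Y') * ser g = euler (ser g - ser h) - Y' * (ser g - ser h) := by
    rw [euler_sub, eY, eY']; noncomm_ring
  have hv' : VanishBelow n ((Y - Y') * ser g) := by
    rw [e]; exact hv.euler.sub (hv.mul_left _)
  have hvY : VanishBelow n (Y - Y') := by
    have := hv'.mul_right (ser g⁻¹)
    rwa [mul_assoc, ser_mul_ser_inv, mul_one] at this
  have hc := congrArg (PowerSeries.coeff n) e
  rw [hvY.coeff_mul_right, coeff_zero_ser, mul_one, map_sub _ (euler _), coeff_euler,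
    hv.coeff_mul_left, vanishBelow_one_of_lieSpan hY' 0 one_pos, zero_mul, sub_zero] at hc
  rw [← inv_smul_smul₀ (show (n : ℂ) ≠ 0 by exact_mod_cast hn.ne') (PowerSeries.coeff n _), ← hc,
    map_sub]
  exact Submodule.smul_mem _ _ (Submodule.sub_mem _ (hY n) (hY' n))

theorem mem_lieType_iff {g : G} :
    g ∈ lieType ↔ ∀ n, PowerSeries.coeff n (euler (ser g) * ser g⁻¹) ∈ lieSpan n := by
  constructor
  · rintro ⟨Y, hY, e⟩
    rwa [e, mul_assoc, ser_mul_ser_inv, mul_one]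
  · intro h
    exact ⟨_, h, by rw [mul_assoc, ser_inv_mul_ser, mul_one]⟩

theorem isClosed_lieType : IsClosed lieType := by
  rw [← closure_subset_iff_isClosed]
  intro g hg
  rw [mem_lieType_iff]
  intro n
  by_contra hn
  obtain ⟨ℓ, hℓ0, hℓ⟩ := Submodule.exists_le_ker_of_notMem hn
  have key : ∀ h : G, ℓ (PowerSeries.coeff n (euler (ser h) * ser h⁻¹))
      = ∑ w ∈ words n, conv (fun u => wt u * wordCoeff (ser h) u) (wordCoeff (ser h⁻¹)) w
          * ℓ (wordMonomial w) := by
    intro h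
    have hm := seriesAlg.mul_mem (euler_mem (ser_mem h)) (ser_mem h⁻¹)
    conv_lhs => rw [eq_sum_words (hm n), map_sum]
    refine Finset.sum_congr rfl fun w hw => ?_
    rw [map_smul, coefW_coeff hm, if_pos (mem_words.mp hw), smul_eq_mul,
      wordCoeff_mul (euler_mem (ser_mem h)) (ser_mem h⁻¹)]
    congr 2
    funext u
    exact wordCoeff_euler _ _
  have hcont : Continuous fun h : G => ℓ (PowerSeries.coeff n (euler (ser h) * ser h⁻¹)) := by
    simp_rw [key, conv]
    refine continuous_finsetSum _ fun w _ => (continuous_finsetSum _ fun k _ => ?_).mul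
      continuous_const
    exact (continuous_const.mul (continuous_wordCoeff _)).mul (continuous_wordCoeff_inv _)
  have hcl : IsClosed {h : G | ℓ (PowerSeries.coeff n (euler (ser h) * ser h⁻¹)) = 0} :=
    isClosed_eq hcont continuous_const
  have hsub : lieType ⊆ {h : G | ℓ (PowerSeries.coeff n (euler (ser h) * ser h⁻¹)) = 0} :=
    fun h hh => hℓ (mem_lieType_iff.mp hh n)
  exact hℓ0 (closure_minimal hsub hcl hg)

theorem ser_E (T : ℝ) (a : ℕ+ → ℝ → ℂ) : ser (E T a) = ofCoeff fun w => iterInt a w T := by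
  have h : ser (E T a) = ofCoeff fun w => basicIntegral T a w.reverse := rfl
  simpa only [basicIntegral, List.reverse_reverse] using h

theorem coeff_ofCoeff_logCoeff (a : ℕ+ → ℝ → ℂ) (x : ℝ) (n : ℕ) :
    PowerSeries.coeff n (ofCoeff fun u => logCoeff a u x)
      = ∑ w ∈ words n, ((lastLetter w : ℂ) * iterInt a w x) • nestedBracket w := by
  refine coefW_ext fun u => ?_
  rw [coefW_coeff (ofCoeff_mem _), wordCoeff_ofCoeff, map_sum]
  split_ifs with h
  · subst h
    refine Finset.sum_congr rfl fun w _ => ?_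
    rw [map_smul, smul_eq_mul]; ring
  · symm
    refine Finset.sum_eq_zero fun w hw => ?_
    have hm := nestedBracket_mem w
    rw [mem_words.mp hw] at hm
    rw [map_smul, coefW_eq_zero hm h, smul_zero]

theorem euler_ser_E {T : ℝ} (hT : 0 < T) {a : ℕ+ → ℝ → ℂ} (ha : a ∈ pathCoeffs T) :
    euler (ser (E T a)) = (ofCoeff fun u => logCoeff a u T) * ser (E T a) := by
  refine series_ext (euler_mem (ser_mem _)) (seriesAlg.mul_mem (ofCoeff_mem _) (ser_mem _)) fun w => ?_
  rw [wordCoeff_euler, wordCoeff_mul (ofCoeff_mem _) (ser_mem _), ser_E, wordCoeff_ofCoeff,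
    iterInt_log_deriv hT ha w T (by simp)]
  congr 1 <;> funext u <;> rw [wordCoeff_ofCoeff]

theorem E_mem_lieType {T : ℝ} (hT : 0 < T) {a : ℕ+ → ℝ → ℂ} (ha : a ∈ pathCoeffs T) :
    E T a ∈ lieType := by
  refine ⟨_, fun n => ?_, euler_ser_E hT ha⟩
  rw [coeff_ofCoeff_logCoeff]
  refine Submodule.sum_mem _ fun w hw => Submodule.smul_mem _ _ ?_
  rw [← mem_words.mp hw]
  exact nestedBracket_mem_lieSpan w

theorem formalPaths_subset_lieType {T : ℝ} (hT : 0 < T) : formalPaths T ⊆ lieType := by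
  refine closure_minimal ?_ isClosed_lieType
  rintro _ ⟨a, ha, rfl⟩
  exact E_mem_lieType hT ha

/-! ### Products of paths -/

/-- The measurable paths whose bound holds everywhere. -/
def boundedPaths : Set (ℕ+ → ℝ → ℂ) :=
  {a | (∀ i, Measurable (a i)) ∧ ∃ M : ℝ, ∀ (i : ℕ+) (x : ℝ), ‖a i x‖ ≤ M ^ (i : ℕ)}

theorem boundedPaths_subset (T : ℝ) : boundedPaths ⊆ pathCoeffs T := fun _ ha =>
  ⟨fun i => (ha.1 i).aemeasurable,
    ha.2.imp fun _ hM i => Filter.Eventually.of_forall fun x => hM i x⟩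

/-- The path `a` followed by the path `b`, each one traversed at double speed. -/
def concat (T : ℝ) (b a : ℕ+ → ℝ → ℂ) (i : ℕ+) (x : ℝ) : ℂ :=
  if x ≤ T / 2 then 2 * a i (2 * x) else 2 * b i (2 * x - T)

theorem concat_mem {T : ℝ} {a b : ℕ+ → ℝ → ℂ} (ha : a ∈ boundedPaths) (hb : b ∈ boundedPaths) :
    concat T b a ∈ boundedPaths := by
  obtain ⟨hma, M, hM⟩ := ha
  obtain ⟨hmb, N, hN⟩ := hb
  refine ⟨fun i => ?_, 2 * max |M| |N|, fun i x => ?_⟩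
  · refine Measurable.ite measurableSet_Iic ?_ ?_
    · exact ((hma i).comp (measurable_const_mul 2)).const_mul 2
    · exact ((hmb i).comp ((measurable_const_mul 2).sub_const T)).const_mul 2
  · have h2 : (2 : ℝ) ≤ 2 ^ (i : ℕ) := le_self_pow₀ one_le_two i.pos.ne'
    have key : ∀ (K : ℝ) (z : ℂ), |K| ≤ max |M| |N| → ‖z‖ ≤ K ^ (i : ℕ) →
        ‖2 * z‖ ≤ (2 * max |M| |N|) ^ (i : ℕ) := by
      intro K z hK hz
      rw [norm_mul, mul_pow]
      have h1 : ‖z‖ ≤ (max |M| |N|) ^ (i : ℕ) :=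
        calc ‖z‖ ≤ K ^ (i : ℕ) := hz
          _ ≤ |K| ^ (i : ℕ) := by rw [← abs_pow]; exact le_abs_self _
          _ ≤ _ := pow_le_pow_left₀ (abs_nonneg K) hK _
      simpa using mul_le_mul h2 h1 (norm_nonneg z) (by positivity)
    rw [concat]
    split_ifs
    · exact key M _ (le_max_left _ _) (hM i _)
    · exact key N _ (le_max_right _ _) (hN i _)

theorem iterInt_concat_half {T : ℝ} (a b : ℕ+ → ℝ → ℂ) :
    ∀ w, ∀ x, 0 ≤ x → x ≤ T → iterInt (concat T b a) w (x / 2) = iterInt a w x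
  | [], _, _, _ => rfl
  | j :: w, x, h0, hx => by
    have h := intervalIntegral.integral_comp_div (a := 0) (b := x)
      (fun s => concat T b a j s * iterInt (concat T b a) w s) (two_ne_zero (α := ℝ))
    rw [zero_div] at h
    have h' : ∫ s in (0 : ℝ)..x, concat T b a j (s / 2) * iterInt (concat T b a) w (s / 2)
        = ∫ s in (0 : ℝ)..x, 2 * (a j s * iterInt a w s) := by
      refine intervalIntegral.integral_congr fun s hs => ?_
      rw [Set.uIcc_of_le h0] at hs
      rw [iterInt_concat_half a b w s hs.1 (hs.2.trans hx), concat,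
        if_pos (by linarith [hs.2]), mul_div_cancel₀ _ (two_ne_zero (α := ℝ)), mul_assoc]
    rw [h', intervalIntegral.integral_const_mul] at h
    simp only [iterInt]
    have h2 : (2 : ℂ) ≠ 0 := two_ne_zero
    refine mul_left_cancel₀ h2 ?_
    rw [h, Complex.real_smul, Complex.ofReal_ofNat]

theorem intervalIntegrable_mul_iterInt {T : ℝ} (hT : 0 < T) {a : ℕ+ → ℝ → ℂ} (ha : a ∈ pathCoeffs T)
    (j : ℕ+) (w : List ℕ+) {x y : ℝ} (hx : x ∈ Set.uIcc 0 T) (hy : y ∈ Set.uIcc 0 T) :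
    IntervalIntegrable (fun s => a j s * iterInt a w s) volume x y :=
  ((pathCoeffs_intervalIntegrable hT ha j).mul_continuousOn
    (acDeriv_iterInt hT ha w).1.continuousOn).mono_set (Set.uIcc_subset_uIcc hx hy)

/-- Chen's identity. The outermost integral is split at `T / 2`: the first piece is the full
integral over `a`, and on the second the induction hypothesis expands the integrand. The later path
`b` supplies the left factor. -/
theorem iterInt_concat {T : ℝ} (hT : 0 < T) {a b : ℕ+ → ℝ → ℂ} (ha : a ∈ boundedPaths)
    (hb : b ∈ boundedPaths) : ∀ w, ∀ x, 0 ≤ x → x ≤ T → iterInt (concat T b a) w (x / 2 + T / 2)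
      = conv (fun u => iterInt b u x) (fun u => iterInt a u T) w
  | [], _, _, _ => by simp [conv_nil, iterInt]
  | j :: w, x, h0, hx => by
    have hc := boundedPaths_subset T (concat_mem (T := T) ha hb)
    have hb' := boundedPaths_subset T hb
    have hm0 : (0 : ℝ) ∈ Set.uIcc 0 T := by simp
    have hm1 : T / 2 ∈ Set.uIcc 0 T := by rw [Set.uIcc_of_le hT.le]; constructor <;> linarith
    have hm2 : x / 2 + T / 2 ∈ Set.uIcc 0 T := by rw [Set.uIcc_of_le hT.le]; constructor <;> linarith
    have hmx : x ∈ Set.uIcc 0 T := by rw [Set.uIcc_of_le hT.le]; exact ⟨h0, hx⟩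
    have hsplit := intervalIntegral.integral_add_adjacent_intervals
      (intervalIntegrable_mul_iterInt hT hc j w hm0 hm1)
      (intervalIntegrable_mul_iterInt hT hc j w hm1 hm2)
    have h1 := iterInt_concat_half a b (j :: w) T hT.le le_rfl
    have h := intervalIntegral.integral_comp_div_add (a := 0) (b := x)
      (fun s => concat T b a j s * iterInt (concat T b a) w s) (two_ne_zero (α := ℝ)) (T / 2)
    rw [zero_div, zero_add] at h
    have h' : ∫ s in (0 : ℝ)..x, concat T b a j (s / 2 + T / 2)
          * iterInt (concat T b a) w (s / 2 + T / 2)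
        = ∫ s in (0 : ℝ)..x, 2 * ∑ k ∈ Finset.range (w.length + 1),
            (b j s * iterInt b (w.take k) s) * iterInt a (w.drop k) T := by
      -- The half-open interval is needed: at `s = 0` the point `T / 2` still belongs to the first
      -- branch of `concat`.
      refine intervalIntegral.integral_congr_ae (Filter.Eventually.of_forall fun s hs => ?_)
      rw [Set.uIoc_of_le h0] at hs
      rw [iterInt_concat hT ha hb w s hs.1.le (hs.2.trans hx), concat,
        if_neg (by linarith [hs.1]), conv, show 2 * (s / 2 + T / 2) - T = s by ring, mul_assoc,
        Finset.mul_sum]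
      simp only [mul_assoc]
    rw [h', intervalIntegral.integral_const_mul, intervalIntegral.integral_finsetSum] at h
    · simp only [intervalIntegral.integral_mul_const] at h
      have h2 : (2 : ℂ) ≠ 0 := two_ne_zero
      rw [Complex.real_smul, Complex.ofReal_ofNat] at h
      have h3 := mul_left_cancel₀ h2 h
      rw [conv_cons]
      change ∫ s in (0 : ℝ)..(x / 2 + T / 2), _ = _
      rw [← hsplit, ← h3]
      change iterInt (concat T b a) (j :: w) (T / 2) + _ = _
      rw [h1]
      simp only [iterInt, one_mul, conv]
    · intro k _
      exact (intervalIntegrable_mul_iterInt hT hb' j (w.take k) hm0 hmx).mul_const _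

theorem E_concat {T : ℝ} (hT : 0 < T) {a b : ℕ+ → ℝ → ℂ} (ha : a ∈ boundedPaths)
    (hb : b ∈ boundedPaths) : E T (concat T b a) = E T b * E T a := by
  refine ser_injective (series_ext (ser_mem _) (ser_mem _) fun w => ?_)
  rw [ser_mul, wordCoeff_mul (ser_mem _) (ser_mem _)]
  simp only [ser_E]
  have h := iterInt_concat hT ha hb w T hT.le le_rfl
  rw [add_halves] at h
  rw [wordCoeff_ofCoeff, h]
  congr 1 <;> funext u <;> rw [wordCoeff_ofCoeff]

/-! ### Constant paths with a single nonzero coefficient -/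

/-- The path with `a_i = c` and all other coefficients zero. -/
def single (i : ℕ+) (c : ℂ) (j : ℕ+) (_ : ℝ) : ℂ := if j = i then c else 0

theorem single_mem (i : ℕ+) (c : ℂ) : single i c ∈ boundedPaths := by
  refine ⟨fun j => measurable_const, max 1 ‖c‖, fun j x => ?_⟩
  have h : max 1 ‖c‖ ≤ (max 1 ‖c‖) ^ (j : ℕ) := le_self_pow₀ (le_max_left _ _) j.pos.ne'
  rw [single]
  split_ifs
  · exact (le_max_right _ _).trans h
  · rw [norm_zero]
    exact (zero_le_one.trans (le_max_left _ _)).trans h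

theorem iterInt_eq_zero {a : ℕ+ → ℝ → ℂ} {j : ℕ+} (hj : ∀ x, a j x = 0) :
    ∀ w, j ∈ w → ∀ x, iterInt a w x = 0
  | i :: w, h, x => by
    rw [iterInt]
    rcases List.mem_cons.mp h with rfl | h
    · simp [hj]
    · simp [iterInt_eq_zero hj w h]

theorem nestedBracket_replicate (i : ℕ+) : ∀ k, nestedBracket (List.replicate (k + 2) i) = 0
  | 0 => by simp [nestedBracket, List.replicate, Ring.lie_def]
  | k + 1 => by
    have h : List.replicate (k + 1 + 2) i = i :: i :: List.replicate (k + 1) i := by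
      simp [List.replicate_succ]
    rw [h, nestedBracket, ← List.replicate_succ, nestedBracket_replicate i k, Ring.lie_def,
      mul_zero, zero_mul, sub_zero]

/-- Only the word `[i]` survives: another letter kills the iterated integral, and a repetition of
`i` kills the commutator. -/
theorem coeff_logCoeff_single (i : ℕ+) (c : ℂ) (x : ℝ) (n : ℕ) :
    PowerSeries.coeff n (ofCoeff fun u => logCoeff (single i c) u x)
      = if n = i then (i * (x * c) : ℂ) • X i else 0 := by
  rw [coeff_ofCoeff_logCoeff]
  have h : ∀ w : List ℕ+, w ≠ [i] →
      ((lastLetter w : ℂ) * iterInt (single i c) w x) • nestedBracket w = 0 := by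
    intro w hw
    by_cases hall : ∀ j ∈ w, j = i
    · rw [List.eq_replicate_of_mem hall] at hw ⊢
      match h : w.length with
      | 0 => simp [nestedBracket]
      | 1 => simp [h] at hw
      | k + 2 => rw [nestedBracket_replicate, smul_zero]
    · push Not at hall
      obtain ⟨j, hj, hji⟩ := hall
      rw [iterInt_eq_zero (j := j) (fun _ => by simp [single, hji]) w hj, mul_zero, zero_smul]
  split_ifs with hn
  · rw [Finset.sum_eq_single [i] (fun w _ hw => h w hw)]
    · simp [lastLetter, iterInt, single, nestedBracket]
    · intro hi
      exact absurd (mem_words.mpr (by simp [hn])) hi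
  · refine Finset.sum_eq_zero fun w hw => h w ?_
    rintro rfl
    exact hn (by rw [← mem_words.mp hw]; simp)

theorem log_single_eq (i : ℕ+) (c : ℂ) (x : ℝ) : (ofCoeff fun u => logCoeff (single i c) u x)
    = PowerSeries.monomial (i : ℕ) ((i * (x * c) : ℂ) • X i) := by
  ext n
  rw [coeff_logCoeff_single, PowerSeries.coeff_monomial]

theorem euler_single {T : ℝ} (hT : 0 < T) (i : ℕ+) (c : ℂ) : euler (ser (E T (single i c)))
    = PowerSeries.monomial (i : ℕ) ((i * (T * c) : ℂ) • X i) * ser (E T (single i c)) := by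
  rw [← log_single_eq]
  exact euler_ser_E hT (boundedPaths_subset T (single_mem i c))

theorem vanishBelow_monomial (n : ℕ) (p : NCPoly) : VanishBelow n (PowerSeries.monomial n p) :=
  fun k hk => by rw [PowerSeries.coeff_monomial, if_neg hk.ne]

theorem hasLead_single {T : ℝ} (hT : 0 < T) (i : ℕ+) (c : ℂ) :
    HasLead i ((T * c : ℂ) • X i) (E T (single i c)) := by
  have h := HasLead.of_euler i.pos (vanishBelow_monomial i _) (euler_single hT i c)
  rw [PowerSeries.coeff_monomial, if_pos rfl, smul_smul, ← mul_assoc, inv_mul_cancel₀, one_mul] at h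
  · exact h
  · exact_mod_cast i.pos.ne'

theorem monomial_smul_X (i : ℕ+) (d : ℂ) : PowerSeries.monomial (i : ℕ) (d • X i)
    = d • (PowerSeries.C (X i) * PowerSeries.X ^ (i : ℕ)) := by
  ext n
  rw [PowerSeries.coeff_smul, PowerSeries.coeff_C_mul, PowerSeries.coeff_X_pow,
    PowerSeries.coeff_monomial]
  split_ifs <;> simp

/-- As `X_i` commutes with the logarithmic derivative `Y`, the commutator of `X_i` with the series
solves `θf = Yf` with no constant term. -/
theorem commute_C_single {T : ℝ} (hT : 0 < T) (i : ℕ+) (c : ℂ) :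
    Commute (PowerSeries.C (X i)) (ser (E T (single i c))) := by
  set A := ser (E T (single i c)) with hA
  set W : NCSeries := PowerSeries.C (X i) with hW
  set Y := PowerSeries.monomial (i : ℕ) ((i * (T * c) : ℂ) • X i) with hY
  have hWY : W * Y = Y * W := by
    rw [hY, monomial_smul_X, mul_smul_comm, smul_mul_assoc, ← hW, mul_assoc,
      (PowerSeries.commute_X_pow W (i : ℕ)).eq]
  refine sub_eq_zero.mp (eq_zero_of_euler_eq (Z := Y)
    ((vanishBelow_monomial _ _).mono i.pos) ?_ ?_)
  · simp [PowerSeries.coeff_zero_eq_constantCoeff, hA, hW]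
  · rw [euler_sub, euler_mul, euler_mul, hW, euler_C, hA, euler_single hT, ← hA, ← hW, ← hY]
    rw [zero_mul, zero_add, mul_zero, add_zero, mul_sub, ← mul_assoc, hWY]
    simp only [mul_assoc]

theorem E_single_mul_neg {T : ℝ} (hT : 0 < T) (i : ℕ+) (c : ℂ) :
    E T (single i c) * E T (single i (-c)) = 1 := by
  refine ser_injective (sub_eq_zero.mp (eq_zero_of_euler_eq (Z := 0) (fun _ _ => map_zero _) ?_ ?_))
  · simp [PowerSeries.coeff_zero_eq_constantCoeff]
  · have hc : Commute (PowerSeries.monomial (i : ℕ) ((i * (T * c) : ℂ) • X i))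
        (ser (E T (single i c))) := by
      rw [monomial_smul_X]
      exact ((commute_C_single hT i c).mul_left
        ((PowerSeries.commute_X_pow _ (i : ℕ)).symm)).smul_left _
    have hneg : PowerSeries.monomial (i : ℕ) ((i * (T * (-c)) : ℂ) • X i)
        = -PowerSeries.monomial (i : ℕ) ((i * (T * c) : ℂ) • X i) := by
      rw [← map_neg, ← neg_smul]; congr 2; ring
    rw [ser_mul, ser_one, euler_sub, euler_one, sub_zero, zero_mul, euler_mul, euler_single hT,
      euler_single hT, hneg, hc.eq]
    noncomm_ring

/-- The group generated by the constant paths with a single nonzero coefficient. -/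
def singleGroup (T : ℝ) : Subgroup G := Subgroup.closure {g | ∃ i c, E T (single i c) = g}

theorem E_zero (T : ℝ) : E T (fun _ _ => 0) = 1 := by
  refine ser_injective (series_ext (ser_mem _) (ser_mem _) fun w => ?_)
  rw [ser_E, wordCoeff_ofCoeff, ser_one, wordCoeff_one]
  cases w with
  | nil => rfl
  | cons j w => rw [iterInt_eq_zero (j := j) (fun _ => rfl) _ (by simp), if_neg (by simp)]

theorem singleGroup_subset {T : ℝ} (hT : 0 < T) :
    (singleGroup T : Set G) ⊆ E T '' boundedPaths := by
  let N : Submonoid G :=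
    { carrier := E T '' boundedPaths
      one_mem' := ⟨_, ⟨fun _ => measurable_const, 0, fun i x => by simp⟩, E_zero T⟩
      mul_mem' := by
        rintro _ _ ⟨b, hb, rfl⟩ ⟨a, ha, rfl⟩
        exact ⟨_, concat_mem ha hb, E_concat hT ha hb⟩ }
  -- As a monoid the subgroup is generated by the one-letter paths and their inverses, and the
  -- inverse for `c` is the path for `-c`.
  have h : (singleGroup T).toSubmonoid ≤ N := by
    rw [singleGroup, Subgroup.closure_toSubmonoid, Submonoid.closure_le]
    rintro g (⟨i, c, rfl⟩ | ⟨i, c, hg⟩)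
    · exact ⟨_, single_mem i c, rfl⟩
    · refine ⟨_, single_mem i (-c), ?_⟩
      rw [← inv_inv g, ← hg]
      exact eq_inv_of_mul_eq_one_right (E_single_mul_neg hT i c)
  exact h

theorem exists_singleGroup_hasLead_X {T : ℝ} (hT : 0 < T) (i : ℕ+) (c : ℂ) :
    ∃ k ∈ singleGroup T, HasLead i (c • X i) k := by
  refine ⟨_, Subgroup.subset_closure ⟨i, c / T, rfl⟩, ?_⟩
  have h := hasLead_single hT i (c / T)
  rwa [mul_div_cancel₀ _ (by exact_mod_cast hT.ne')] at h

/-- Iterated group commutators of one-letter paths lead with iterated Lie commutators; by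
multilinearity the scalar is placed on the innermost letter. -/
theorem exists_singleGroup_hasLead {T : ℝ} (hT : 0 < T) :
    ∀ (w : List ℕ+), w ≠ [] → ∀ c : ℂ, ∃ k ∈ singleGroup T, HasLead (wt w) (c • nestedBracket w) k
  | [i], _, c => by simpa [nestedBracket] using exists_singleGroup_hasLead_X hT i c
  | i :: j :: w, _, c => by
    obtain ⟨k, hk, hlead⟩ := exists_singleGroup_hasLead hT (j :: w) (by simp) c
    obtain ⟨l, hl, hlead'⟩ := exists_singleGroup_hasLead_X hT i 1
    refine ⟨l * k * l⁻¹ * k⁻¹, ?_, ?_⟩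
    · exact (singleGroup T).mul_mem ((singleGroup T).mul_mem ((singleGroup T).mul_mem hl hk)
        ((singleGroup T).inv_mem hl)) ((singleGroup T).inv_mem hk)
    · have h := hlead'.commutator hlead
      rw [← wt_cons, one_smul] at h
      convert h using 1
      rw [nestedBracket, Ring.lie_def, Ring.lie_def, mul_smul_comm, smul_mul_assoc, smul_sub]

theorem exists_singleGroup_agree {T : ℝ} (hT : 0 < T) {g : G} (hg : g ∈ lieType) (n : ℕ) :
    ∃ h ∈ singleGroup T, VanishBelow n (ser g - ser h) := by
  refine exists_agree_of_lead _ _ (fun n hn h hh hv => ?_) n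
  have hh' : h ∈ lieType := by
    obtain ⟨a, ha, rfl⟩ := singleGroup_subset hT hh
    exact E_mem_lieType hT (boundedPaths_subset T ha)
  refine exists_lead_of_mem_span _ hn _ ?_ (coeff_sub_mem_lieSpan hg hh' hn hv)
  rintro _ ⟨w, rfl, rfl⟩ c
  refine exists_singleGroup_hasLead hT w ?_ c
  rintro rfl
  simp at hn

theorem vanishBelow_mul_sub_mul {n : ℕ} {f f' g g' : NCSeries} (hf : VanishBelow n (f - f'))
    (hg : VanishBelow n (g - g')) : VanishBelow n (f * g - f' * g') := by
  have e : f * g - f' * g' = (f - f') * g + f' * (g - g') := by noncomm_ring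
  rw [e]
  exact (hf.mul_right _).add (hg.mul_left _)

theorem vanishBelow_inv {n : ℕ} {g h : G} (hv : VanishBelow n (ser g - ser h)) :
    VanishBelow n (ser g⁻¹ - ser h⁻¹) := by
  have e : ser g⁻¹ - ser h⁻¹ = -(ser g⁻¹ * (ser g - ser h) * ser h⁻¹) := by
    rw [mul_sub, sub_mul, ser_inv_mul_ser, mul_assoc, ser_mul_ser_inv]; simp
  rw [e]
  intro k hk
  rw [map_neg, (hv.mul_left _).mul_right _ k hk, neg_zero]

/-- The elements which agree to every order with elements of `S`. -/
def approxGroup (S : Subgroup G) : Subgroup G where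
  carrier := {g | ∀ n, ∃ h ∈ S, VanishBelow n (ser g - ser h)}
  mul_mem' := by
    intro a b ha hb n
    obtain ⟨h, hh, hv⟩ := ha n
    obtain ⟨k, hk, hv'⟩ := hb n
    exact ⟨h * k, S.mul_mem hh hk, vanishBelow_mul_sub_mul hv hv'⟩
  one_mem' := fun n => ⟨1, S.one_mem, fun k _ => by simp⟩
  inv_mem' := by
    intro a ha n
    obtain ⟨h, hh, hv⟩ := ha n
    exact ⟨h⁻¹, S.inv_mem hh, vanishBelow_inv hv⟩

theorem approxGroup_subset_formalPaths {T : ℝ} (hT : 0 < T) :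
    (approxGroup (singleGroup T) : Set G) ⊆ formalPaths T := by
  intro g hg
  refine closure_mono ?_ (mem_closure_of_agree (S := (singleGroup T : Set G)) hg)
  exact (singleGroup_subset hT).trans (Set.image_mono (boundedPaths_subset T))

theorem lieType_subset_approxGroup {T : ℝ} (hT : 0 < T) :
    lieType ⊆ (approxGroup (singleGroup T) : Set G) :=
  fun _ hg n => exists_singleGroup_agree hT hg n

/-! ### The representation defining the first return map -/

/-- The operator `f ↦ (m ↦ (m + 1) f(m + i))`; these satisfy `[D_i, D_j] = (i - j) D_{i+j}`. -/
def shiftOp (i : ℕ) : Module.End ℂ (ℕ → ℂ) where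
  toFun f m := (m + 1) * f (m + i)
  map_add' f g := by funext m; simp [mul_add]
  map_smul' c f := by funext m; simp; ring

@[simp] theorem shiftOp_apply (i : ℕ) (f : ℕ → ℂ) (m : ℕ) :
    shiftOp i f m = (m + 1) * f (m + i) := rfl

/-- The representation `X_i ↦ D_i`. -/
def rep : NCPoly →ₐ[ℂ] Module.End ℂ (ℕ → ℂ) := FreeAlgebra.lift ℂ fun i : ℕ+ => shiftOp i

@[simp] theorem rep_X (i : ℕ+) : rep (X i) = shiftOp i := by simp [rep, X]

theorem rep_nestedBracket : ∀ w : List ℕ+, w ≠ [] →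
    rep (nestedBracket w) = (gam w : ℂ) • shiftOp (wt w)
  | [i], _ => by simp [nestedBracket, gam]
  | i :: j :: w, _ => by
    rw [nestedBracket, Ring.lie_def, map_sub, map_mul, map_mul, rep_nestedBracket (j :: w) (by simp),
      rep_X, gam, wt_cons i]
    refine LinearMap.ext fun f => funext fun m => ?_
    simp only [LinearMap.sub_apply, Module.End.mul_apply, LinearMap.smul_apply, Pi.sub_apply,
      Pi.smul_apply, shiftOp_apply, smul_eq_mul]
    rw [add_right_comm m (wt (j :: w)), add_assoc m (i : ℕ)]
    push_cast
    ring

theorem rep_v {i : List ℕ+} (hi : 2 ≤ i.length) : rep (v i) = 0 := by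
  have hne : i ≠ [] := by rintro rfl; simp at hi
  rw [v, map_sub, map_smul, rep_nestedBracket i hne, rep_X, Nat.toPNat'_coe, if_pos (wt_pos hi),
    sub_self]

/-- The functional which sends `X_{i_k} ⋯ X_{i₁}` to `p_{i₁,…,i_k}(i₁ + ⋯ + i_k)`. -/
def returnFunctional : NCPoly →ₗ[ℂ] ℂ where
  toFun p := rep p (fun _ => 1) 0
  map_add' p q := by simp
  map_smul' c p := by simp

theorem returnFunctional_apply (p : NCPoly) : returnFunctional p = rep p (fun _ => 1) 0 := rfl

theorem returnPoly_append (u : List ℕ+) (i : ℕ+) (z : ℂ) :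
    returnPoly (u ++ [i]) z = returnPoly u z * (z - (wt (u ++ [i]) : ℂ) + 1) := by
  rw [returnPoly, List.length_append, List.length_singleton, Finset.prod_range_succ, returnPoly]
  congr 1
  · refine Finset.prod_congr rfl fun j hj => ?_
    rw [List.take_append_of_le_length (by have := Finset.mem_range.mp hj; omega)]
  · rw [List.take_of_length_le (by simp)]

/-- A general `m` is needed for the induction: stripping a letter `i` replaces `m` by `m + i`, which
keeps `m + wt w` fixed. Only `m = 0` enters the return map. -/
theorem rep_wordMonomial : ∀ (w : List ℕ+) (m : ℕ),
    rep (wordMonomial w) (fun _ => 1) m = returnPoly w.reverse (m + wt w)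
  | [], m => by simp [returnPoly]
  | i :: w, m => by
    rw [wordMonomial_cons, map_mul, Module.End.mul_apply, rep_X, shiftOp_apply,
      rep_wordMonomial w (m + i), List.reverse_cons, returnPoly_append, ← List.reverse_cons,
      wt_reverse, wt_cons]
    push_cast
    rw [add_assoc (m : ℂ)]
    ring

theorem returnFunctional_coeff {f : NCSeries} (hf : f ∈ seriesAlg) (n : ℕ) :
    returnFunctional (PowerSeries.coeff n f)
      = ∑ w ∈ words n, returnPoly w n * wordCoeff f w.reverse := by
  rw [← sum_words_reverse, eq_sum_words (hf n), map_sum]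
  refine Finset.sum_congr rfl fun w hw => ?_
  rw [map_smul, coefW_coeff hf, if_pos (mem_words.mp hw), returnFunctional_apply, rep_wordMonomial,
    mem_words.mp hw, List.reverse_reverse, smul_eq_mul, mul_comm]
  simp

theorem coeff_firstReturn (g : G) (n : ℕ) : PowerSeries.coeff (n + 1) (firstReturn g)
    = if n = 0 then 1 else returnFunctional (PowerSeries.coeff n (ser g)) := by
  rw [firstReturn, map_add, PowerSeries.coeff_succ_X_mul, PowerSeries.coeff_mk,
    PowerSeries.coeff_X, returnFunctional_coeff (ser_mem g),
    ← sum_composition n (fun w => returnPoly w n * wordCoeff (ser g) w.reverse)]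
  by_cases h : n = 0 <;> simp [h, formalIntegral]

theorem firstReturn_eq_X_iff (g : G) : firstReturn g = PowerSeries.X
    ↔ ∀ n, 0 < n → returnFunctional (PowerSeries.coeff n (ser g)) = 0 := by
  constructor
  · intro h n hn
    have := coeff_firstReturn g n
    rw [if_neg hn.ne', h, PowerSeries.coeff_X, if_neg (by omega)] at this
    exact this.symm
  · intro h
    ext n
    cases n with
    | zero => simp [firstReturn]
    | succ n =>
      rw [coeff_firstReturn, PowerSeries.coeff_X]
      rcases Nat.eq_zero_or_pos n with rfl | hn
      · simp
      · rw [if_neg hn.ne', h n hn, if_neg (by omega)]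

/-- The action of the series in `G` by power series of operators. -/
def repG : G →* PowerSeries (Module.End ℂ (ℕ → ℂ)) where
  toFun g := PowerSeries.map (rep : NCPoly →+* Module.End ℂ (ℕ → ℂ)) (ser g)
  map_one' := by simp
  map_mul' g h := by simp

theorem repG_apply (g : G) :
    repG g = PowerSeries.map (rep : NCPoly →+* Module.End ℂ (ℕ → ℂ)) (ser g) := rfl

/-- `returnFunctional` is not multiplicative, so triviality on a generated group is obtained through
the homomorphism `repG`. -/
theorem firstReturn_of_repG {g : G} (hg : repG g = 1) : firstReturn g = PowerSeries.X := by
  rw [firstReturn_eq_X_iff]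
  intro n hn
  have := congrArg (PowerSeries.coeff n) hg
  rw [repG_apply, PowerSeries.coeff_map, PowerSeries.coeff_one, if_neg hn.ne'] at this
  rw [returnFunctional_apply]
  change (rep : NCPoly →+* Module.End ℂ (ℕ → ℂ)) _ _ _ = _
  rw [this]
  rfl

/-! ### The exponentials `exp(c v t^n)` -/

theorem ser_exp_lieElem (i : List ℕ+) (hi : 2 ≤ i.length) (c : ℂ) :
    ser (exp (lieElem i hi c)) = expSeries (PowerSeries.monomial (wt i) (c • v i)) := by
  have h : ser (exp (lieElem i hi c)) = expSeries (c • PowerSeries.monomial (wt i) (v i)) := rfl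
  rw [h, ← LinearMap.map_smul_of_tower]

theorem repG_exp_lieElem (i : List ℕ+) (hi : 2 ≤ i.length) (c : ℂ) :
    repG (exp (lieElem i hi c)) = 1 := by
  ext1 n
  rw [repG_apply, ser_exp_lieElem, PowerSeries.coeff_map, expSeries, PowerSeries.coeff_mk, map_sum,
    Finset.sum_range_succ', Finset.sum_eq_zero]
  · rw [PowerSeries.coeff_one]
    split_ifs with h <;> simp [PowerSeries.coeff_one, h]
  · intro k _
    have h0 : PowerSeries.map (rep : NCPoly →+* Module.End ℂ (ℕ → ℂ))
        (PowerSeries.monomial (wt i) (c • v i)) = 0 := by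
      ext1 m
      rw [PowerSeries.coeff_map, PowerSeries.coeff_monomial]
      split_ifs <;> simp [rep_v hi]
    have h1 := congrArg (PowerSeries.coeff n) (map_pow (PowerSeries.map
      (rep : NCPoly →+* Module.End ℂ (ℕ → ℂ))) (PowerSeries.monomial (wt i) (c • v i)) (k + 1))
    rw [h0, zero_pow (Nat.succ_ne_zero k), PowerSeries.coeff_map] at h1
    have h2 : rep (PowerSeries.coeff n (PowerSeries.monomial (wt i) (c • v i) ^ (k + 1))) = 0 := h1
    change rep _ = 0
    rw [map_smul, h2, smul_zero]

theorem repG_of_mem_H {g : G} (hg : g ∈ H) : repG g = 1 := by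
  have h : H ≤ repG.ker := by
    rw [H, Subgroup.closure_le]
    rintro _ ⟨i, hi, c, rfl⟩
    exact repG_exp_lieElem i hi c
  exact h hg

theorem VanishBelow.pow {f : NCSeries} (hf : VanishBelow 1 f) : ∀ k, VanishBelow k (f ^ k)
  | 0 => VanishBelow.zero _
  | k + 1 => by rw [pow_succ]; exact (VanishBelow.pow hf k).mul hf

theorem coeff_expSeries {f : NCSeries} (hf : VanishBelow 1 f) {n N : ℕ} (hN : n < N) :
    PowerSeries.coeff n (expSeries f)
      = ∑ k ∈ Finset.range N, ((k.factorial : ℂ)⁻¹) • PowerSeries.coeff n (f ^ k) := by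
  rw [expSeries, PowerSeries.coeff_mk]
  refine Finset.sum_subset (by simpa using hN) fun k _ hk => ?_
  rw [hf.pow k n (by simpa using hk), smul_zero]

theorem euler_monomial (n : ℕ) (p : NCPoly) :
    euler (PowerSeries.monomial n p) = (n : ℂ) • PowerSeries.monomial n p := by
  ext m
  rw [coeff_euler, PowerSeries.coeff_smul, PowerSeries.coeff_monomial]
  split_ifs with h
  · rw [h]
  · simp

theorem euler_monomial_pow (n : ℕ) (p : NCPoly) (k : ℕ) :
    euler (PowerSeries.monomial n p ^ k) = (k * n : ℂ) • PowerSeries.monomial n p ^ k := by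
  induction k with
  | zero => simp [euler_one]
  | succ k ih =>
    rw [pow_succ, euler_mul, ih, euler_monomial, smul_mul_assoc, mul_smul_comm, ← add_smul]
    congr 1
    push_cast
    ring

theorem euler_expSeries {n : ℕ} (hn : 0 < n) (p : NCPoly) :
    euler (expSeries (PowerSeries.monomial n p))
      = PowerSeries.monomial n ((n : ℂ) • p) * expSeries (PowerSeries.monomial n p) := by
  set f := PowerSeries.monomial n p with hf
  have hv : VanishBelow 1 f := (vanishBelow_monomial n p).mono hn
  have hnf : PowerSeries.monomial n ((n : ℂ) • p) = (n : ℂ) • f := by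
    rw [hf, ← LinearMap.map_smul_of_tower]
  ext m
  -- One superfluous term is kept in the exponential sum, so that dropping `k = 0` leaves exactly
  -- the `m + 1` terms of the other side.
  rw [hnf, smul_mul_assoc, PowerSeries.coeff_smul, coeff_euler,
    coeff_expSeries hv (show m < m + 1 + 1 by omega), Finset.smul_sum]
  have h1 : ∀ k : ℕ, (m : ℂ) • ((k.factorial : ℂ)⁻¹) • PowerSeries.coeff m (f ^ k)
      = ((k.factorial : ℂ)⁻¹ * (k * n)) • PowerSeries.coeff m (f ^ k) := by
    intro k
    have := congrArg (PowerSeries.coeff m) (euler_monomial_pow n p k)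
    rw [coeff_euler, PowerSeries.coeff_smul, ← hf] at this
    rw [smul_comm, this, smul_smul]
  have h2 : PowerSeries.coeff m (f * expSeries f)
      = ∑ k ∈ Finset.range (m + 1), ((k.factorial : ℂ)⁻¹) • PowerSeries.coeff m (f ^ (k + 1)) := by
    rw [PowerSeries.coeff_mul]
    have : ∀ q ∈ Finset.HasAntidiagonal.antidiagonal m, PowerSeries.coeff q.1 f * PowerSeries.coeff q.2 (expSeries f)
        = ∑ k ∈ Finset.range (m + 1), ((k.factorial : ℂ)⁻¹) •
          (PowerSeries.coeff q.1 f * PowerSeries.coeff q.2 (f ^ k)) := by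
      intro q hq
      have hq' := Finset.HasAntidiagonal.mem_antidiagonal.mp hq
      rw [coeff_expSeries hv (show q.2 < m + 1 by omega), Finset.mul_sum]
      simp only [mul_smul_comm]
    rw [Finset.sum_congr rfl this, Finset.sum_comm]
    refine Finset.sum_congr rfl fun k _ => ?_
    rw [← Finset.smul_sum, ← PowerSeries.coeff_mul, ← pow_succ']
  rw [Finset.sum_congr rfl fun k _ => h1 k, Finset.sum_range_succ', h2, Finset.smul_sum]
  simp only [Nat.cast_zero, zero_mul, mul_zero, zero_smul, add_zero]
  refine Finset.sum_congr rfl fun k _ => ?_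
  rw [smul_smul]
  congr 1
  have h3 : ((k : ℂ) + 1) ≠ 0 := by exact_mod_cast Nat.succ_ne_zero k
  rw [Nat.factorial_succ]
  push_cast
  rw [mul_inv]
  field_simp

theorem v_mem_lieSpan {i : List ℕ+} (hi : 2 ≤ i.length) : v i ∈ lieSpan (wt i) := by
  refine Submodule.sub_mem _ (nestedBracket_mem_lieSpan i) (Submodule.smul_mem _ _ ?_)
  refine Submodule.subset_span ⟨[(wt i).toPNat'], ?_, rfl⟩
  rw [wt_cons, Nat.toPNat'_coe, if_pos (wt_pos hi), wt_nil, add_zero]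

theorem euler_exp_lieElem (i : List ℕ+) (hi : 2 ≤ i.length) (c : ℂ) :
    euler (ser (exp (lieElem i hi c)))
      = PowerSeries.monomial (wt i) ((wt i : ℂ) • c • v i) * ser (exp (lieElem i hi c)) := by
  rw [ser_exp_lieElem]
  exact euler_expSeries (wt_pos hi) _

theorem exp_lieElem_mem_lieType (i : List ℕ+) (hi : 2 ≤ i.length) (c : ℂ) :
    exp (lieElem i hi c) ∈ lieType := by
  refine ⟨_, fun n => ?_, euler_exp_lieElem i hi c⟩
  rw [PowerSeries.coeff_monomial]
  split_ifs with h
  · rw [h]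
    exact Submodule.smul_mem _ _ (Submodule.smul_mem _ _ (v_mem_lieSpan hi))
  · exact Submodule.zero_mem _

theorem hasLead_exp_lieElem (i : List ℕ+) (hi : 2 ≤ i.length) (c : ℂ) :
    HasLead (wt i) (c • v i) (exp (lieElem i hi c)) := by
  have h := HasLead.of_euler (wt_pos hi) (vanishBelow_monomial _ _) (euler_exp_lieElem i hi c)
  rwa [PowerSeries.coeff_monomial, if_pos rfl, inv_smul_smul₀] at h
  exact_mod_cast (wt_pos hi).ne'

theorem H_subset_formalPaths {T : ℝ} (hT : 0 < T) : (H : Set G) ⊆ formalPaths T := by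
  -- Approximable elements form a group, so it suffices to treat the generators, which are of Lie
  -- type.
  have h : H ≤ approxGroup (singleGroup T) := by
    rw [H, Subgroup.closure_le]
    rintro _ ⟨i, hi, c, rfl⟩
    exact lieType_subset_approxGroup hT (exp_lieElem_mem_lieType i hi c)
  exact fun g hg => approxGroup_subset_formalPaths hT (h hg)

/-! ### Approximation of formal centers -/

theorem lieSpan_le (n : ℕ) (hn : 0 < n) : lieSpan n ≤
    Submodule.span ℂ {p | ∃ w : List ℕ+, 2 ≤ w.length ∧ wt w = n ∧ v w = p} ⊔ ℂ ∙ X n.toPNat' := by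
  refine Submodule.span_le.mpr ?_
  rintro _ ⟨w, hw, rfl⟩
  match w, hw with
  | [], hw => simp at hw; omega
  | [i], hw =>
    refine Submodule.mem_sup_right ?_
    have : i = n.toPNat' := by
      apply PNat.coe_injective
      rw [← hw]; simp
    rw [← this]
    exact Submodule.mem_span_singleton_self _
  | i :: j :: w, hw =>
    have : nestedBracket (i :: j :: w) = v (i :: j :: w) + (gam (i :: j :: w) : ℂ) • X n.toPNat' := by
      rw [v, hw, sub_add_cancel]
    rw [this]
    exact Submodule.add_mem_sup (Submodule.subset_span ⟨_, by simp, hw, rfl⟩)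
      (Submodule.smul_mem _ _ (Submodule.mem_span_singleton_self _))

/-- The functional vanishes on every `v` and equals 1 on `X_n`, so it detects the `X_n` component
exactly. -/
theorem mem_span_v {n : ℕ} (hn : 0 < n) {u : NCPoly} (hu : u ∈ lieSpan n)
    (h0 : returnFunctional u = 0) :
    u ∈ Submodule.span ℂ {p | ∃ w : List ℕ+, 2 ≤ w.length ∧ wt w = n ∧ v w = p} := by
  obtain ⟨p, hp, q, hq, rfl⟩ := Submodule.mem_sup.mp (lieSpan_le n hn hu)
  obtain ⟨c, rfl⟩ := Submodule.mem_span_singleton.mp hq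
  have hp0 : returnFunctional p = 0 := by
    have : Submodule.span ℂ {p | ∃ w : List ℕ+, 2 ≤ w.length ∧ wt w = n ∧ v w = p}
        ≤ LinearMap.ker returnFunctional := by
      refine Submodule.span_le.mpr ?_
      rintro _ ⟨w, hw, -, rfl⟩
      simp [returnFunctional_apply, rep_v hw]
    exact this hp
  have hX : returnFunctional (X n.toPNat') = 1 := by simp [returnFunctional_apply]
  rw [map_add, hp0, map_smul, hX, zero_add, smul_eq_mul, mul_one] at h0
  simpa [h0] using hp

theorem exists_H_agree {g : G} (hg : g ∈ lieType) (h0 : firstReturn g = PowerSeries.X)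
    (hH : (H : Set G) ⊆ lieType) (n : ℕ) : ∃ h ∈ H, VanishBelow n (ser g - ser h) := by
  refine exists_agree_of_lead _ _ (fun n hn h hh hv => ?_) n
  have hu := coeff_sub_mem_lieSpan hg (hH hh) hn hv
  have hr : returnFunctional (PowerSeries.coeff n (ser g - ser h)) = 0 := by
    rw [map_sub, map_sub, (firstReturn_eq_X_iff g).mp h0 n hn,
      (firstReturn_eq_X_iff h).mp (firstReturn_of_repG (repG_of_mem_H hh)) n hn, sub_zero]
  refine exists_lead_of_mem_span _ hn _ ?_ (mem_span_v hn hu hr)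
  rintro _ ⟨w, hw, rfl, rfl⟩ c
  exact ⟨_, Subgroup.subset_closure ⟨w, hw, c, rfl⟩, hasLead_exp_lieElem w hw c⟩

theorem isClosed_firstReturn_eq_X : IsClosed {g : G | firstReturn g = PowerSeries.X} := by
  simp only [firstReturn_eq_X_iff, returnFunctional_coeff (ser_mem _), Set.ofPred_forall]
  refine isClosed_iInter fun n => isClosed_iInter fun _ => isClosed_eq ?_ continuous_const
  exact continuous_finsetSum _ fun w _ => continuous_const.mul (continuous_wordCoeff _)

end FormalCenters
end

theorem proposition3p7 (T : ℝ) (hT : 0 < T) :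
    (FormalCenters.H : Set FormalCenters.G) ⊆ FormalCenters.formalPaths T ∧
      FormalCenters.formalCenters T =
        closure {g : FormalCenters.formalPaths T | (g : FormalCenters.G) ∈ FormalCenters.H} := by
  have hH := FormalCenters.H_subset_formalPaths hT
  have hL := FormalCenters.formalPaths_subset_lieType hT
  refine ⟨hH, Set.Subset.antisymm ?_ ?_⟩
  · rintro ⟨g, hg⟩ h0
    have hcl : g ∈ closure (FormalCenters.H : Set FormalCenters.G) :=
      FormalCenters.mem_closure_of_agree
        (FormalCenters.exists_H_agree (hL hg) h0 (hH.trans hL))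
    rw [closure_subtype]
    -- Since `H` lies in `formalPaths T`, the image in `G` of its trace on the subtype is `H`
    -- itself.
    convert hcl using 2
    ext x
    constructor
    · rintro ⟨y, hy, rfl⟩
      exact hy
    · intro hx
      exact ⟨⟨x, hH hx⟩, hx, rfl⟩
  · refine closure_minimal ?_ (FormalCenters.isClosed_firstReturn_eq_X.preimage
      continuous_subtype_val)
    intro g hg
    exact FormalCenters.firstReturn_of_repG (FormalCenters.repG_of_mem_H hg)
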